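/- Let $q$ be a complex number with $|q|<1$. Write $(a;p)_0=1$, $(a;p)_n=\prod_{i=1}^{n}(1-ap^{i-1})$, $(a;p)_\infty=\prod_{i\ge1}(1-ap^{i-1})$, $(a)_n=(a;q)_n$, $(a)_\infty=(a;q)_\infty$, and $(a_1,\dots,a_r;p)_\infty=\prod_i (a_i;p)_\infty$. For a partition $\lambda=(\lambda_1\ge\lambda_2\ge\cdots\ge 0)$ let $l(\lambda)$ be the number of its positive parts, $n_2(\lambda)=\sum_i\lambda_i^2$ and $(a;p)_\lambda=(a;p)_{\lambda_1-\lambda_2}(a;p)_{\lambda_2-\lambda_3}\cdots$. Then for every integer $k\ge1$ the following six identities hold, where each sum runs over all partitions $\lambda$ with at most $k$ positive parts and converges absolutely: $$\sum_{l(\lambda)\le k}\frac{q^{2n_2(\lambda)}}{(q;q^2)_{\lambda_k}(q^2;q^2)_\lambda}=\prod_n(1-q^n)^{-1},\tag{11}$$ the product being over all $n\ge1$ with $n\equiv\pm(2k+1),\pm(2k+3),\pm2,\pm4,\dots,\pm4k\pmod{8k+8}$; $$\sum_{l(\lambda)\le k}\frac{q^{2n_2(\lambda)-2\lambda_1}}{(q;q^2)_{\lambda_k}(q^2;q^2)_\lambda}(1-q^{2\lambda_1})=\frac{(q^{4k-2},q^{4k+10};q^{8k+8})_\infty}{\prod_n(1-q^n)},\tag{12}$$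 the product being over all $n\ge1$ with $n\equiv\pm(2k-1),\pm(2k+5),\pm2,\pm4,\dots,\pm4k,\pm(4k+2)\pmod{8k+8}$; $$\sum_{l(\lambda)\le k}\frac{q^{2n_2(\lambda)-\lambda_1^2}}{(q;q^2)_{\lambda_k}(q^2;q^2)_\lambda}(-q;q^2)_{\lambda_1}=\frac{(-q;q^2)_\infty}{(q^2;q^2)_\infty}(q^{4k+2},-q^{2k},-q^{2k+2};q^{4k+2})_\infty;\tag{13}$$ $$\sum_{l(\lambda)\le k}\frac{q^{2n_2(\lambda)-\lambda_1^2-\lambda_1}}{(q;q^2)_{\lambda_k}(q^2;q^2)_\lambda}(-1;q^2)_{\lambda_1}(1-q^{2\lambda_1})=2\,\frac{(-q^2;q^2)_\infty}{(q^2;q^2)_\infty}(q^{4k+2},-q^{2k-1},-q^{2k+3};q^{4k+2})_\infty;\tag{14}$$ $$\sum_{l(\lambda)\le k}\frac{q^{2n_2(\lambda)-2\lambda_1^2+\lambda_1}}{(q;q^2)_{\lambda_k}(q^2;q^2)_\lambda}(-1;q^2)_{\lambda_1}(-q;q^2)_{\lambda_1}=\frac{(-q)_\infty}{(q)_\infty}(q^{4k},-q^{2k},-q^{2k};q^{4k})_\infty;\tag{15}$$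 $$\sum_{l(\lambda)\le k}\frac{q^{2n_2(\lambda)-\lambda_1^2+\lambda_1}}{(q;q^2)_{\lambda_k}(q^2;q^2)_\lambda}(-1;q^2)_{\lambda_1}=\frac{(-q^2;q^2)_\infty}{(q^2;q^2)_\infty}(q^{4k+2},-q^{2k+1},-q^{2k+1};q^{4k+2})_\infty.\tag{16}$$ Moreover, from (15) and (16) with $k=1$ one has the single-sum identities $$1+2\sum_{n\ge1}q^n\frac{(-q)_{2n-1}}{(q)_{2n}}=\frac{(q^4,-q^2,-q^2;q^4)_\infty}{(q)_\infty(q;q^2)_\infty},\qquad 1+2\sum_{n\ge1}q^{n(n+1)}\frac{(-q^2;q^2)_{n-1}}{(q)_{2n}}=\frac{(q^6,-q^3,-q^3;q^6)_\infty}{(q)_\infty(-q;q^2)_\infty}.$$ -/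

import Mathlib

namespace RRSums

/-- The finite shifted factorial `(a; p)_n = ∏_{i=1}^{n} (1 - a p^{i-1})`. -/
def qPoch (a p : ℂ) (n : ℕ) : ℂ := ∏ i ∈ Finset.range n, (1 - a * p ^ i)

/-- The infinite shifted factorial `(a; p)_∞ = ∏_{i ≥ 1} (1 - a p^{i-1})` (used for `‖p‖ < 1`). -/
noncomputable def qPochInf (a p : ℂ) : ℂ := ∏' i : ℕ, (1 - a * p ^ i)

/-- The product defining `(a; p)_∞` converges when `‖p‖ < 1`. -/
theorem multipliable_qPochInf (a : ℂ) {p : ℂ} (hp : ‖p‖ < 1) :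
    Multipliable fun i : ℕ => 1 - a * p ^ i := by
  simp only [sub_eq_add_neg]
  apply multipliable_one_add_of_summable
  simpa using (summable_geometric_of_lt_one (norm_nonneg _) hp).mul_left ‖a‖

/-- The triple product `(a, b, c; p)_∞ = (a; p)_∞ (b; p)_∞ (c; p)_∞`. -/
noncomputable def qPochInf₃ (a b c p : ℂ) : ℂ := qPochInf a p * qPochInf b p * qPochInf c p

/-- The positive integers `n` with `n ≡ r` or `n ≡ -r (mod M)` for some `r ∈ R`. -/
def residueClasses (M : ℤ) (R : Set ℤ) : Set ℕ :=
  {n | 1 ≤ n ∧ ∃ r ∈ R, (n : ℤ) ≡ r [ZMOD M] ∨ (n : ℤ) ≡ -r [ZMOD M]}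

/-- The product of `1 - q^n` over all positive integers `n ≡ ± r (mod M)`, `r ∈ R`. -/
noncomputable def residueProd (q : ℂ) (M : ℤ) (R : Set ℤ) : ℂ :=
  ∏' n : residueClasses M R, (1 - q ^ (n : ℕ))

/-- The product defining `residueProd` converges when `‖q‖ < 1`. -/
theorem multipliable_residueProd {q : ℂ} (hq : ‖q‖ < 1) (M : ℤ) (R : Set ℤ) :
    Multipliable fun n : residueClasses M R => 1 - q ^ (n : ℕ) := by
  simp only [sub_eq_add_neg]
  apply multipliable_one_add_of_summable
  simp only [norm_neg, norm_pow]
  exact (summable_geometric_of_lt_one (norm_nonneg _) hq).subtype (residueClasses M R)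

/-- The even integers `2, 4, …, 2m`. -/
def evensUpTo (m : ℕ) : Set ℤ := {r | ∃ j : ℕ, 1 ≤ j ∧ j ≤ m ∧ r = 2 * (j : ℤ)}

/-- Partitions with at most `k` parts, as weakly decreasing sequences of naturals that vanish
from index `k` on. Indices start at `0`: the part `λ_i` of the literature is `l (i - 1)`. -/
def BddPartition (k : ℕ) : Type :=
  {l : ℕ → ℕ // Antitone l ∧ ∀ i, k ≤ i → l i = 0}

namespace BddPartition

variable {k : ℕ}

/-- The part with index `i` (starting from `0`). -/
def part (l : BddPartition k) (i : ℕ) : ℕ := l.1 i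

/-- The largest part `λ_1`. -/
def first (l : BddPartition k) : ℕ := l.part 0

/-- The part `λ_k`, which is zero if the partition has fewer than `k` positive parts. -/
def last (l : BddPartition k) : ℕ := l.part (k - 1)

/-- `n₂(λ) = ∑ λ_i ^ 2`. -/
def n₂ (l : BddPartition k) : ℕ := ∑ i ∈ Finset.range k, l.part i ^ 2

/-- `(a; p)_λ = (a; p)_{λ_1 - λ_2} (a; p)_{λ_2 - λ_3} ⋯`. -/
def poch (l : BddPartition k) (a p : ℂ) : ℂ :=
  ∏ i ∈ Finset.range k, qPoch a p (l.part i - l.part (i + 1))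

/-- The common denominator `(q; q²)_{λ_k} (q²; q²)_λ`. -/
def denom (l : BddPartition k) (q : ℂ) : ℂ :=
  qPoch q (q ^ 2) l.last * l.poch (q ^ 2) (q ^ 2)

end BddPartition

end RRSums

namespace RRSums

open Filter Topology Finset

/-! All six sums come from one Bailey chain in base `p = q ^ 2`. Since (q;q²)_n (q²;q²)_n =
(q;q)_{2n}, the smallest part contributes β_n = 1/(q;q)_{2n}. This belongs to a Bailey pair whose
α_r is the folded sequence `seed`, with terms q^(2r² ± r) (`sum_antidiagonal_seed`). The largest
part enters through a weight w(λ_1), all other factors through `tailTerm`.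

Put γ_r = ∑_m w(r+m) / ((p;p)_m (p;p)_{2r+m}). For one part, exchanging summations turns ∑ w β into
∑ α γ. Summing out the largest part replaces w by another weight, and q-Vandermonde shows that γ_r
is merely multiplied by p^(r²) (`bailey_step`). Hence the sum over partitions with at most k+1 parts
is ∑_r α_r p^(k r²) γ_r (`hasSum_tailTerm`).

The weights are products of factors A - s p^i and B - t p^i and a power d^n, so γ_r is a q-Gauss sum
(`hasSum_gaussTerm`); taking A or B to be 0 covers the limits of infinite parameters without any
limiting process. The extra factor 1 - p^(λ_1) in two of the sums splits γ_r into two such values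
(`hasSum_weight_one_sub'`). In each case the resulting series in r is a theta series, which the
Jacobi triple product (`hasSum_theta`) evaluates. Two of the products are then rewritten over
residue classes, and the single sums are the one-part case after Euler's identity. -/

/-! ### Finite and infinite shifted factorials -/

theorem qPoch_zero (a p : ℂ) : qPoch a p 0 = 1 := by simp [qPoch]

theorem qPoch_succ (a p : ℂ) (n : ℕ) : qPoch a p (n + 1) = qPoch a p n * (1 - a * p ^ n) := by
  simp [qPoch, prod_range_succ]

theorem qPoch_succ' (a p : ℂ) (n : ℕ) : qPoch a p (n + 1) = (1 - a) * qPoch (a * p) p n := by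
  simp only [qPoch, prod_range_succ']
  rw [mul_comm]
  simp only [pow_zero, mul_one, pow_succ']
  congr 1
  exact prod_congr rfl fun i _ => by ring

theorem qPoch_add (a p : ℂ) (m n : ℕ) :
    qPoch a p (m + n) = qPoch a p m * qPoch (a * p ^ m) p n := by
  simp only [qPoch, prod_range_add]
  congr 1
  exact prod_congr rfl fun i _ => by rw [pow_add]; ring

theorem tendsto_qPoch (a : ℂ) {p : ℂ} (hp : ‖p‖ < 1) :
    Tendsto (fun n => qPoch a p n) atTop (𝓝 (qPochInf a p)) :=
  (multipliable_qPochInf a hp).hasProd.tendsto_prod_nat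

theorem qPochInf_shift (a : ℂ) {p : ℂ} (hp : ‖p‖ < 1) (n : ℕ) :
    qPochInf a p = qPoch a p n * qPochInf (a * p ^ n) p := by
  have h1 : Tendsto (fun m => qPoch a p (n + m)) atTop (𝓝 (qPochInf a p)) := by
    have := (tendsto_add_atTop_iff_nat n).2 (tendsto_qPoch a hp)
    simpa only [add_comm] using this
  simp only [qPoch_add] at h1
  exact tendsto_nhds_unique h1 ((tendsto_qPoch _ hp).const_mul _)

theorem qPochInf_zero (p : ℂ) : qPochInf 0 p = 1 := by simp [qPochInf]

theorem qPochInf_ne_zero {a p : ℂ} (hp : ‖p‖ < 1) (h : ∀ i : ℕ, a * p ^ i ≠ 1) :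
    qPochInf a p ≠ 0 := by
  have := tprod_one_add_ne_zero_of_summable (f := fun i : ℕ => -(a * p ^ i))
    (fun i => by rw [← sub_eq_add_neg]; exact sub_ne_zero.2 (h i).symm)
    (by simpa using (summable_geometric_of_lt_one (norm_nonneg _) hp).mul_left ‖a‖)
  simpa [qPochInf, sub_eq_add_neg] using this

theorem qPoch_ne_zero {a p : ℂ} (h : ∀ i : ℕ, a * p ^ i ≠ 1) (n : ℕ) : qPoch a p n ≠ 0 :=
  prod_ne_zero_iff.2 fun i _ => sub_ne_zero.2 (h i).symm

theorem mul_pow_ne_one {a p : ℂ} (ha : ‖a‖ < 1) (hp : ‖p‖ < 1) (i : ℕ) : a * p ^ i ≠ 1 := by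
  intro h
  have h1 : ‖a * p ^ i‖ = 1 := by rw [h]; simp
  rw [norm_mul, norm_pow] at h1
  have := pow_le_one₀ (n := i) (norm_nonneg p) hp.le
  nlinarith [norm_nonneg a, norm_nonneg p]

theorem norm_pow_succ_lt {p : ℂ} (hp : ‖p‖ < 1) {n : ℕ} (hn : n ≠ 0) : ‖p ^ n‖ < 1 := by
  rw [norm_pow]; exact pow_lt_one₀ (norm_nonneg _) hp hn

theorem exists_norm_qPoch_le (a : ℂ) {p : ℂ} (hp : ‖p‖ < 1) : ∃ C, ∀ n, ‖qPoch a p n‖ ≤ C := by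
  obtain ⟨C, hC⟩ := (tendsto_qPoch a hp).norm.bddAbove_range
  exact ⟨C, fun n => hC ⟨n, rfl⟩⟩

theorem exists_norm_inv_qPoch_le {a p : ℂ} (hp : ‖p‖ < 1) (h : ∀ i : ℕ, a * p ^ i ≠ 1) :
    ∃ C, 0 ≤ C ∧ ∀ n, ‖(qPoch a p n)⁻¹‖ ≤ C := by
  obtain ⟨C, hC⟩ := ((tendsto_qPoch a hp).inv₀ (qPochInf_ne_zero hp h)).norm.bddAbove_range
  exact ⟨C, (norm_nonneg _).trans (hC ⟨0, rfl⟩), fun n => hC ⟨n, rfl⟩⟩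

/-- The reciprocal `1 / (p; p)_n`. -/
noncomputable def invPoch (p : ℂ) (n : ℕ) : ℂ := (qPoch p p n)⁻¹

theorem self_pow_ne_one {p : ℂ} (hp : ‖p‖ < 1) (i : ℕ) : p * p ^ i ≠ 1 := mul_pow_ne_one hp hp i

theorem invPoch_zero (p : ℂ) : invPoch p 0 = 1 := by simp [invPoch, qPoch]

theorem invPoch_eq {p : ℂ} (hp : ‖p‖ < 1) (n : ℕ) :
    invPoch p n = (1 - p ^ (n + 1)) * invPoch p (n + 1) := by
  have h1 := qPoch_ne_zero (self_pow_ne_one hp) n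
  have h2 := qPoch_ne_zero (self_pow_ne_one hp) (n + 1)
  have h3 := qPoch_succ p p n
  unfold invPoch
  rw [pow_succ']
  field_simp
  rw [h3]

theorem exists_norm_invPoch_le {p : ℂ} (hp : ‖p‖ < 1) : ∃ C, 0 ≤ C ∧ ∀ n, ‖invPoch p n‖ ≤ C :=
  exists_norm_inv_qPoch_le hp (self_pow_ne_one hp)

theorem tendsto_invPoch {p : ℂ} (hp : ‖p‖ < 1) :
    Tendsto (invPoch p) atTop (𝓝 (qPochInf p p)⁻¹) :=
  (tendsto_qPoch p hp).inv₀ (qPochInf_ne_zero hp (self_pow_ne_one hp))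

/-! ### The q-Gauss summation -/

/-- The shifted product `∏_{i < n} (A - s p^i)`. -/
noncomputable def shiftProd (A s p : ℂ) (n : ℕ) : ℂ := ∏ i ∈ range n, (A - s * p ^ i)

theorem shiftProd_succ (A s p : ℂ) (n : ℕ) :
    shiftProd A s p (n + 1) = shiftProd A s p n * (A - s * p ^ n) := by
  simp [shiftProd, prod_range_succ]

theorem shiftProd_zero (A s p : ℂ) : shiftProd A s p 0 = 1 := by simp [shiftProd]

theorem shiftProd_add (A s p : ℂ) (m n : ℕ) :
    shiftProd A s p (m + n) = shiftProd A s p m * shiftProd A (s * p ^ m) p n := by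
  simp only [shiftProd, prod_range_add]
  congr 1
  exact prod_congr rfl fun i _ => by rw [pow_add]; ring

/-- The weights `∏_{i < n} (A - s p^i) (B - t p^i) d`. -/
noncomputable def weight (A s B t d p : ℂ) (n : ℕ) : ℂ :=
  shiftProd A s p n * shiftProd B t p n * d ^ n

theorem weight_succ (A s B t d p : ℂ) (n : ℕ) :
    weight A s B t d p (n + 1) =
      weight A s B t d p n * ((A - s * p ^ n) * (B - t * p ^ n) * d) := by
  simp only [weight, shiftProd_succ]; ring

theorem weight_zero (A s B t d p : ℂ) : weight A s B t d p 0 = 1 := by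
  simp [weight, shiftProd_zero]

theorem weight_add (A s B t d p : ℂ) (m n : ℕ) :
    weight A s B t d p (m + n) =
      weight A s B t d p m * weight A (s * p ^ m) B (t * p ^ m) d p n := by
  simp only [weight, shiftProd_add]; ring

theorem weight_mul (A s B t d x p : ℂ) (n : ℕ) :
    weight A s B t (d * x) p n = weight A s B t d p n * x ^ n := by
  simp only [weight]; ring

theorem summable_norm_weight (A s B t d : ℂ) {p : ℂ} (hp : ‖p‖ < 1) (h : ‖d * A * B‖ < 1) :
    Summable fun n => ‖weight A s B t d p n‖ := by
  obtain ⟨ρ, h1, h2⟩ := exists_between h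
  have hl : Tendsto (fun n : ℕ => ‖(A - s * p ^ n) * (B - t * p ^ n) * d‖) atTop
      (𝓝 ‖(A - s * 0) * (B - t * 0) * d‖) := by
    have := tendsto_pow_atTop_nhds_zero_of_norm_lt_one hp
    exact (((tendsto_const_nhds.sub (this.const_mul s)).mul
      (tendsto_const_nhds.sub (this.const_mul t))).mul_const d).norm
  have he : ‖(A - s * 0) * (B - t * 0) * d‖ = ‖d * A * B‖ := by congr 1; ring
  rw [he] at hl
  refine summable_of_ratio_norm_eventually_le h2 ?_
  filter_upwards [hl.eventually_lt_const h1] with n hn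
  rw [norm_norm, norm_norm, weight_succ, norm_mul, mul_comm]
  gcongr

/-- The terms of the `q`-Gauss series. -/
noncomputable def gaussTerm (A s B t d p : ℂ) (m : ℕ) : ℂ :=
  weight A s B t d p m * (invPoch p m * (qPoch (s * t * d) p m)⁻¹)

theorem summable_norm_gaussTerm {A s B t d p : ℂ} (hp : ‖p‖ < 1) (h : ‖d * A * B‖ < 1)
    (hc : ∀ i : ℕ, s * t * d * p ^ i ≠ 1) : Summable fun m => ‖gaussTerm A s B t d p m‖ := by
  obtain ⟨C, hC0, hC⟩ := exists_norm_invPoch_le hp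
  obtain ⟨D, hD0, hD⟩ := exists_norm_inv_qPoch_le hp hc
  refine Summable.of_nonneg_of_le (fun _ => norm_nonneg _) (fun m => ?_)
    ((summable_norm_weight A s B t d hp h).mul_right (C * D))
  rw [gaussTerm, norm_mul, norm_mul]
  have := hC m
  have := hD m
  gcongr

theorem qPoch_mul_shift (c p : ℂ) (m : ℕ) :
    qPoch c p m * (1 - c * p ^ m) = (1 - c) * qPoch (c * p) p m := by
  rw [← qPoch_succ, qPoch_succ']

theorem gaussTerm_mul {A s B t d p : ℂ} (hc : ∀ i : ℕ, s * t * d * p ^ i ≠ 1) (m : ℕ) :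
    gaussTerm A s B t (d * p) p m * (1 - s * t * d * p ^ m) =
      gaussTerm A s B t d p m * p ^ m * (1 - s * t * d) := by
  have h1 := qPoch_mul_shift (s * t * d) p m
  have h2 := qPoch_ne_zero hc m
  have h3 : 1 - s * t * d ≠ 0 := sub_ne_zero.2 (by simpa using (hc 0).symm)
  have h5 := sub_ne_zero.2 (hc m).symm
  have h4 : qPoch (s * t * d * p) p m ≠ 0 := by
    intro h; rw [h, mul_zero] at h1
    exact mul_ne_zero h2 h5 h1
  simp only [gaussTerm, weight_mul, ← mul_assoc]
  field_simp
  linear_combination (weight A s B t d p m * p ^ m * invPoch p m) * h1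

/-- A contiguous relation between the series at `d` and at `d * p`: the combination of their terms
is a difference in `m`. The remaining boundary term tends to 0, so the two full sums differ by an
explicit factor. -/
theorem gaussTerm_telescope {A s B t d p : ℂ} (hp : ‖p‖ < 1)
    (hc : ∀ i : ℕ, s * t * d * p ^ i ≠ 1) (M : ℕ) :
    ∑ m ∈ range M, ((1 - s * t * d) * (1 - d * A * B) * gaussTerm A s B t d p m -
        (1 - t * d * A) * (1 - s * d * B) * gaussTerm A s B t (d * p) p m) =
      - ((1 - s * t * d) * (1 - p ^ M) * gaussTerm A s B t d p M) := by
  induction M with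
  | zero => simp
  | succ M ih =>
    rw [sum_range_succ, ih]
    have h5 := sub_ne_zero.2 (hc M).symm
    have h6 : gaussTerm A s B t d p (M + 1) * (1 - p ^ (M + 1)) * (1 - s * t * d * p ^ M) =
        gaussTerm A s B t d p M * ((A - s * p ^ M) * (B - t * p ^ M) * d) := by
      have := invPoch_eq hp M
      have h2 := qPoch_ne_zero hc M
      have h8 : 1 - s * p ^ M * t * d ≠ 0 := by convert h5 using 1; ring
      simp only [gaussTerm, weight_succ, this, qPoch_succ, mul_inv]
      field_simp
    have h7 := gaussTerm_mul (A := A) (B := B) hc M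
    apply mul_right_cancel₀ h5
    linear_combination (1 - s * t * d) * h6 - (1 - t * d * A) * (1 - s * d * B) * h7

theorem tsum_gaussTerm_step {A s B t d p : ℂ} (hp : ‖p‖ < 1) (h : ‖d * A * B‖ < 1)
    (hc : ∀ i : ℕ, s * t * d * p ^ i ≠ 1) :
    (1 - s * t * d) * (1 - d * A * B) * ∑' m, gaussTerm A s B t d p m =
      (1 - t * d * A) * (1 - s * d * B) * ∑' m, gaussTerm A s B t (d * p) p m := by
  have hS := (summable_norm_gaussTerm hp h hc).of_norm
  have h' : ‖d * p * A * B‖ < 1 := by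
    have : d * p * A * B = p * (d * A * B) := by ring
    rw [this, norm_mul]; nlinarith [norm_nonneg p, norm_nonneg (d * A * B)]
  have hc' : ∀ i : ℕ, s * t * (d * p) * p ^ i ≠ 1 := fun i => by
    have := hc (i + 1); rwa [pow_succ', ← mul_assoc, mul_assoc (s * t)] at this
  have hS' := (summable_norm_gaussTerm hp h' hc').of_norm
  have h1 := ((hS.hasSum.mul_left ((1 - s * t * d) * (1 - d * A * B))).sub
    (hS'.hasSum.mul_left ((1 - t * d * A) * (1 - s * d * B)))).tendsto_sum_nat
  simp only [gaussTerm_telescope hp hc] at h1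
  have h2 : Tendsto (fun M => - ((1 - s * t * d) * (1 - p ^ M) * gaussTerm A s B t d p M)) atTop
      (𝓝 (-((1 - s * t * d) * (1 - 0) * 0))) :=
    (((tendsto_const_nhds.sub (tendsto_pow_atTop_nhds_zero_of_norm_lt_one hp)).const_mul _).mul
      hS.tendsto_atTop_zero).neg
  have := tendsto_nhds_unique h1 h2
  linear_combination this

theorem gauss_params {A s B t d p : ℂ} (hp : ‖p‖ < 1) (h : ‖d * A * B‖ < 1)
    (hc : ∀ i : ℕ, s * t * d * p ^ i ≠ 1) (n : ℕ) :
    ‖d * p ^ n * A * B‖ < 1 ∧ ∀ i : ℕ, s * t * (d * p ^ n) * p ^ i ≠ 1 := by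
  constructor
  · have : d * p ^ n * A * B = p ^ n * (d * A * B) := by ring
    rw [this, norm_mul, norm_pow]
    have := pow_le_one₀ (n := n) (norm_nonneg p) hp.le
    nlinarith [norm_nonneg (d * A * B), norm_nonneg p]
  · intro i
    have := hc (n + i); rwa [pow_add, ← mul_assoc, mul_assoc (s * t)] at this

theorem tsum_gaussTerm_iterate {A s B t d p : ℂ} (hp : ‖p‖ < 1) (h : ‖d * A * B‖ < 1)
    (hc : ∀ i : ℕ, s * t * d * p ^ i ≠ 1) (n : ℕ) :
    qPoch (s * t * d) p n * qPoch (d * A * B) p n * ∑' m, gaussTerm A s B t d p m =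
      qPoch (t * d * A) p n * qPoch (s * d * B) p n *
        ∑' m, gaussTerm A s B t (d * p ^ n) p m := by
  induction n with
  | zero => simp [qPoch_zero]
  | succ n ih =>
    obtain ⟨h1, h2⟩ := gauss_params hp h hc n
    have h3 := tsum_gaussTerm_step hp h1 h2
    rw [show d * p ^ n * p = d * p ^ (n + 1) by ring] at h3
    simp only [qPoch_succ]
    linear_combination (1 - s * t * d * p ^ n) * (1 - d * A * B * p ^ n) * ih +
      qPoch (t * d * A) p n * qPoch (s * d * B) p n * h3

/-- Writing the shifted term as the original one times bounded factors gives a majorant uniform in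
`n`, as dominated convergence requires; the factor `(p ^ n) ^ m` kills every term except `m = 0` in
the limit. -/
theorem gaussTerm_shift {A s B t d p : ℂ} (hc : ∀ i : ℕ, s * t * d * p ^ i ≠ 1) (n m : ℕ) :
    gaussTerm A s B t (d * p ^ n) p m = gaussTerm A s B t d p m *
      (qPoch (s * t * d) p m * qPoch (s * t * d) p n * (qPoch (s * t * d) p (n + m))⁻¹) *
        (p ^ n) ^ m := by
  have h1 := qPoch_ne_zero hc
  have h2 := qPoch_add (s * t * d) p n m
  have h3 : qPoch (s * t * d * p ^ n) p m ≠ 0 := right_ne_zero_of_mul (h2 ▸ h1 (n + m))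
  have h4 := h1 n
  have h5 := h1 m
  simp only [gaussTerm, weight_mul, h2, ← mul_assoc]
  field_simp

theorem tendsto_tsum_gaussTerm {A s B t d p : ℂ} (hp : ‖p‖ < 1) (h : ‖d * A * B‖ < 1)
    (hc : ∀ i : ℕ, s * t * d * p ^ i ≠ 1) :
    Tendsto (fun n : ℕ => ∑' m, gaussTerm A s B t (d * p ^ n) p m) atTop (𝓝 1) := by
  obtain ⟨C, hC⟩ := exists_norm_qPoch_le (s * t * d) hp
  obtain ⟨D, hD0, hD⟩ := exists_norm_inv_qPoch_le hp hc
  have hC0 : 0 ≤ C := (norm_nonneg _).trans (hC 0)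
  have key : ∀ n m, ‖gaussTerm A s B t (d * p ^ n) p m‖ ≤
      ‖gaussTerm A s B t d p m‖ * (C * C * D) * ‖(p ^ n) ^ m‖ := fun n m => by
    rw [gaussTerm_shift hc, norm_mul, norm_mul, norm_mul, norm_mul]
    have := hC m
    have := hC n
    have := hD (n + m)
    gcongr
  have h1 : (1 : ℂ) = ∑' m : ℕ, if m = 0 then 1 else 0 := by simp
  rw [h1]
  refine tendsto_tsum_of_dominated_convergence
    ((summable_norm_gaussTerm hp h hc).mul_right (C * C * D)) (fun m => ?_)
    (Eventually.of_forall fun n m => (key n m).trans ?_)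
  · rcases Nat.eq_zero_or_pos m with rfl | hm
    · simp [gaussTerm, weight_zero, invPoch_zero, qPoch_zero]
    · rw [if_neg hm.ne']
      refine squeeze_zero_norm (key · m) ?_
      have hp2 : Tendsto (fun n : ℕ => ‖(p ^ n) ^ m‖) atTop (𝓝 ‖(0 : ℂ) ^ m‖) :=
        ((tendsto_pow_atTop_nhds_zero_of_norm_lt_one hp).pow m).norm
      have := hp2.const_mul (‖gaussTerm A s B t d p m‖ * (C * C * D))
      simpa [hm.ne'] using this
  · refine mul_le_of_le_one_right (by positivity) ?_
    rw [norm_pow, norm_pow]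
    exact pow_le_one₀ (by positivity) (pow_le_one₀ (norm_nonneg _) hp.le)

/-- The `q`-Gauss summation, in a form homogeneous in the parameters. -/
theorem hasSum_gaussTerm {A s B t d p : ℂ} (hp : ‖p‖ < 1) (h : ‖d * A * B‖ < 1)
    (hc : ∀ i : ℕ, s * t * d * p ^ i ≠ 1) :
    HasSum (gaussTerm A s B t d p) (qPochInf (t * d * A) p * qPochInf (s * d * B) p /
      (qPochInf (s * t * d) p * qPochInf (d * A * B) p)) := by
  have h1 := (((tendsto_qPoch (s * t * d) hp).mul (tendsto_qPoch (d * A * B) hp)).mul_const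
    (∑' m, gaussTerm A s B t d p m))
  simp only [tsum_gaussTerm_iterate hp h hc] at h1
  have h2 := ((tendsto_qPoch (t * d * A) hp).mul (tendsto_qPoch (s * d * B) hp)).mul
    (tendsto_tsum_gaussTerm hp h hc)
  have h3 := tendsto_nhds_unique h1 h2
  have h4 := qPochInf_ne_zero hp hc
  have h5 := qPochInf_ne_zero hp (mul_pow_ne_one h hp)
  rw [mul_one] at h3
  rw [← h3, mul_div_cancel_left₀ _ (mul_ne_zero h4 h5)]
  exact (summable_norm_gaussTerm hp h hc).of_norm.hasSum

/-! ### The q-Vandermonde convolution -/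

/-- A finite `q`-Vandermonde summation. -/
theorem sum_antidiagonal_vandermonde {p : ℂ} (hp : ‖p‖ < 1) (N s : ℕ) :
    ∑ x ∈ antidiagonal N, p ^ (x.1 * (x.1 + s)) *
        (invPoch p x.2 * invPoch p x.1 * invPoch p (s + x.1)) =
      invPoch p N * invPoch p (s + N) := by
  induction N generalizing s with
  | zero => simp [invPoch_zero]
  | succ N ih =>
    have h0 : (1 - p ^ (N + 1)) ≠ 0 := by
      rw [pow_succ']; exact sub_ne_zero.2 (self_pow_ne_one hp N).symm
    -- On the antidiagonal, 1 - p^(N+1) = (1 - p^(x.2)) + p^(x.2) (1 - p^(x.1)). The first piece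
    -- lowers `x.2` and keeps `s`; the second lowers `x.1` and replaces `s` by `s + 1`, hence the
    -- induction over all `s`.
    have h1 : (1 - p ^ (N + 1)) * ∑ x ∈ antidiagonal (N + 1), p ^ (x.1 * (x.1 + s)) *
        (invPoch p x.2 * invPoch p x.1 * invPoch p (s + x.1)) =
        (∑ x ∈ antidiagonal (N + 1), (1 - p ^ x.2) * (p ^ (x.1 * (x.1 + s)) *
          (invPoch p x.2 * invPoch p x.1 * invPoch p (s + x.1)))) +
        ∑ x ∈ antidiagonal (N + 1), p ^ x.2 * (1 - p ^ x.1) * (p ^ (x.1 * (x.1 + s)) *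
          (invPoch p x.2 * invPoch p x.1 * invPoch p (s + x.1))) := by
      rw [mul_sum, ← sum_add_distrib]
      refine sum_congr rfl fun x hx => ?_
      rw [← mem_antidiagonal.1 hx, pow_add]; ring
    rw [Finset.Nat.sum_antidiagonal_succ' (f := fun x => (1 - p ^ x.2) * _)] at h1
    rw [Finset.Nat.sum_antidiagonal_succ (f := fun x => p ^ x.2 * (1 - p ^ x.1) * _)] at h1
    have h2 : ∑ x ∈ antidiagonal N, (1 - p ^ (x.2 + 1)) * (p ^ (x.1 * (x.1 + s)) *
        (invPoch p (x.2 + 1) * invPoch p x.1 * invPoch p (s + x.1))) =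
        invPoch p N * invPoch p (s + N) := by
      rw [← ih]
      refine sum_congr rfl fun x _ => ?_
      rw [invPoch_eq hp x.2]; ring
    have h3 : ∑ x ∈ antidiagonal N, p ^ x.2 * (1 - p ^ (x.1 + 1)) *
        (p ^ ((x.1 + 1) * (x.1 + 1 + s)) *
        (invPoch p x.2 * invPoch p (x.1 + 1) * invPoch p (s + (x.1 + 1)))) =
        p ^ (N + 1 + s) * (invPoch p N * invPoch p (s + 1 + N)) := by
      rw [← ih, mul_sum]
      refine sum_congr rfl fun x hx => ?_
      rw [← mem_antidiagonal.1 hx, invPoch_eq hp x.1, show s + 1 + x.1 = s + (x.1 + 1) by ring]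
      ring
    apply mul_left_cancel₀ h0
    refine h1.trans ?_
    simp only [pow_zero, sub_self, zero_mul, mul_zero, zero_add, add_zero]
    rw [h2, h3, invPoch_eq hp (s + N), invPoch_eq hp N,
      show s + 1 + N = s + N + 1 by ring, show s + (N + 1) = s + N + 1 by ring]
    ring

/-! ### The initial Bailey pair -/

/-- The bilateral sequence `q ^ (2 r ^ 2 + r)`, folded onto the nonnegative integers. -/
noncomputable def seed (q : ℂ) (r : ℕ) : ℂ :=
  if r = 0 then 1 else q ^ (2 * r ^ 2 - r) + q ^ (2 * r ^ 2 + r)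

theorem seed_succ (q : ℂ) (r : ℕ) :
    seed q (r + 1) = q ^ (2 * r ^ 2 + 3 * r + 1) + q ^ (2 * r ^ 2 + 5 * r + 3) := by
  have h1 : 2 * (r + 1) ^ 2 - (r + 1) = 2 * r ^ 2 + 3 * r + 1 := by
    have : 2 * (r + 1) ^ 2 = 2 * r ^ 2 + 3 * r + 1 + (r + 1) := by ring
    omega
  have h2 : 2 * (r + 1) ^ 2 + (r + 1) = 2 * r ^ 2 + 5 * r + 3 := by ring
  rw [seed, if_neg (by omega), h1, h2]

/-- The recurrence in `n` for the full sum telescopes in `r` when cut off at `R ≤ n`. Here `n = R +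
m`, which avoids truncated subtraction; raising `R` with `n` fixed lowers `m`, so the induction
keeps `m` free. -/
theorem sum_seed_partial {q : ℂ} (hq : ‖q‖ < 1) (R m : ℕ) :
    ∑ r ∈ range (R + 1), seed q r *
      ((1 - q ^ (2 * (R + m) + 1)) * (1 - q ^ (2 * (R + m) + 2)) *
        (invPoch (q ^ 2) (R + m + 1 - r) * invPoch (q ^ 2) (R + m + 1 + r)) -
        invPoch (q ^ 2) (R + m - r) * invPoch (q ^ 2) (R + m + r)) =
      q ^ (2 * (R + m) + 1) * q ^ (2 * R ^ 2 + R) * (q ^ (2 * R + 1) - 1) *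
        (invPoch (q ^ 2) m * invPoch (q ^ 2) (R + m + 1 + R)) := by
  have hp := norm_pow_succ_lt hq two_ne_zero
  induction R generalizing m with
  | zero =>
    simp only [seed, sum_range_one, zero_add, tsub_zero, add_zero, if_true]
    rw [invPoch_eq hp m]
    ring
  | succ R ih =>
    rw [sum_range_succ]
    have := ih (m + 1)
    rw [show R + (m + 1) = R + 1 + m by ring] at this
    rw [this, seed_succ, show R + 1 + m + 1 - (R + 1) = m + 1 by omega,
      show R + 1 + m - (R + 1) = m by omega, invPoch_eq hp m,
      invPoch_eq hp (R + 1 + m + (R + 1)), invPoch_eq hp (R + 1 + m + 1 + R),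
      show R + 1 + m + (R + 1) + 1 = R + 1 + m + 1 + R + 1 by ring,
      show R + 1 + m + 1 + (R + 1) = R + 1 + m + 1 + R + 1 by ring]
    ring

/-- The Bailey pair with `β_n = 1 / (q; q)_{2n}` relative to base `q ^ 2`. -/
theorem sum_antidiagonal_seed {q : ℂ} (hq : ‖q‖ < 1) (n : ℕ) :
    ∑ x ∈ antidiagonal n, seed q x.1 * (invPoch (q ^ 2) x.2 * invPoch (q ^ 2) (2 * x.1 + x.2)) =
      invPoch q (2 * n) := by
  have hp := norm_pow_succ_lt hq two_ne_zero
  have conv : ∀ n, ∑ x ∈ antidiagonal n,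
      seed q x.1 * (invPoch (q ^ 2) x.2 * invPoch (q ^ 2) (2 * x.1 + x.2)) =
      ∑ r ∈ range (n + 1), seed q r * (invPoch (q ^ 2) (n - r) * invPoch (q ^ 2) (n + r)) := by
    intro n
    rw [Finset.Nat.sum_antidiagonal_eq_sum_range_succ_mk]
    refine sum_congr rfl fun r hr => ?_
    have := mem_range.1 hr
    simp only [show 2 * r + (n - r) = n + r by omega]
  induction n with
  | zero => simp [seed, invPoch_zero]
  | succ n ih =>
    rw [conv] at ih ⊢
    -- With `m = 0` the cutoff is `n` itself, and the boundary term cancels exactly the new term `r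
    -- = n + 1`.
    have h1 := sum_seed_partial hq n 0
    rw [sum_congr rfl fun r _ => mul_sub (seed q r) _ _, sum_sub_distrib] at h1
    simp only [add_zero, ih] at h1
    have h2 : ∀ i : ℕ, 1 - q ^ (i + 1) ≠ 0 := fun i => by
      rw [pow_succ']; exact sub_ne_zero.2 (self_pow_ne_one hq i).symm
    have h3 := h2 (2 * n)
    have h4 := h2 (2 * n + 1)
    apply mul_left_cancel₀ (mul_ne_zero h3 h4)
    rw [sum_range_succ, seed_succ, mul_add, mul_sum]
    rw [invPoch_eq hq, invPoch_eq hq (2 * n + 1)] at h1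
    rw [invPoch_eq hp (n + 1 + n)] at h1
    simp only [Nat.sub_self, invPoch_zero, show 2 * (n + 1) = 2 * n + 1 + 1 by ring,
      show n + 1 + (n + 1) = n + 1 + n + 1 by ring] at h1 ⊢
    have h5 : ∀ r, (1 - q ^ (2 * n + 1)) * (1 - q ^ (2 * n + 1 + 1)) *
        (seed q r * (invPoch (q ^ 2) (n + 1 - r) * invPoch (q ^ 2) (n + 1 + r))) =
        seed q r * ((1 - q ^ (2 * n + 1)) * (1 - q ^ (2 * n + 2)) *
        (invPoch (q ^ 2) (n + 1 - r) * invPoch (q ^ 2) (n + 1 + r))) := fun r => by ring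
    simp only [h5]
    linear_combination h1

/-! ### Theta series and the Jacobi triple product -/

/-- The terms of Ramanujan's theta series, folded onto the nonnegative integers. -/
noncomputable def theta (a b : ℂ) (r : ℕ) : ℂ :=
  if r = 0 then 1 else a ^ (r + 1).choose 2 * b ^ r.choose 2 + b ^ (r + 1).choose 2 * a ^ r.choose 2

theorem sum_theta_partial {a b : ℂ} (hp : ‖a * b‖ < 1) (R m : ℕ) :
    ∑ r ∈ range (R + 1), theta a b r *
      ((1 - (a * b) ^ (2 * (R + m) + 1)) * (1 - (a * b) ^ (2 * (R + m) + 2)) *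
        (invPoch (a * b) (R + m + 1 - r) * invPoch (a * b) (R + m + 1 + r)) -
        (1 + a * (a * b) ^ (R + m)) * (1 + b * (a * b) ^ (R + m)) *
        (invPoch (a * b) (R + m - r) * invPoch (a * b) (R + m + r))) =
      (a * b) ^ (R + m) * (a ^ (R + 1).choose 2 * b ^ R.choose 2 *
          ((a * b) ^ (R + 1) * (1 + a * (a * b) ^ (R + m)) - a * (1 + b * (a * b) ^ (R + m))) +
        b ^ (R + 1).choose 2 * a ^ R.choose 2 *
          ((a * b) ^ (R + 1) * (1 + b * (a * b) ^ (R + m)) - b * (1 + a * (a * b) ^ (R + m)))) *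
        (invPoch (a * b) m * invPoch (a * b) (R + m + 1 + R)) := by
  induction R generalizing m with
  | zero =>
    simp only [theta, sum_range_one, zero_add, tsub_zero, add_zero, if_true]
    rw [invPoch_eq hp m]
    norm_num
    ring
  | succ R ih =>
    rw [sum_range_succ]
    have := ih (m + 1)
    rw [show R + (m + 1) = R + 1 + m by ring] at this
    rw [this, theta, if_neg (by omega), show R + 1 + m + 1 - (R + 1) = m + 1 by omega,
      show R + 1 + m - (R + 1) = m by omega, invPoch_eq hp m,
      invPoch_eq hp (R + 1 + m + (R + 1)), invPoch_eq hp (R + 1 + m + 1 + R),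
      show R + 1 + m + (R + 1) + 1 = R + 1 + m + 1 + R + 1 by ring,
      show R + 1 + m + 1 + (R + 1) = R + 1 + m + 1 + R + 1 by ring]
    have e1 : (R + 1).choose 2 = R.choose 2 + R := by
      rw [Nat.choose_succ_succ' R 1]; simp; ring
    have e2 : (R + 1 + 1).choose 2 = R.choose 2 + R + (R + 1) := by
      rw [Nat.choose_succ_succ' (R + 1) 1, e1]; simp; ring
    rw [e2, e1]
    ring

/-- A finite form of the triple product, proved by the same cutoff telescoping as the initial Bailey
pair; the triple product is its limit as `n → ∞`. -/
theorem sum_antidiagonal_theta {a b : ℂ} (hp : ‖a * b‖ < 1) (n : ℕ) :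
    ∑ x ∈ antidiagonal n,
      theta a b x.1 * (invPoch (a * b) x.2 * invPoch (a * b) (2 * x.1 + x.2)) =
      qPoch (-a) (a * b) n * qPoch (-b) (a * b) n * invPoch (a * b) (2 * n) := by
  have conv : ∀ n, ∑ x ∈ antidiagonal n,
      theta a b x.1 * (invPoch (a * b) x.2 * invPoch (a * b) (2 * x.1 + x.2)) =
      ∑ r ∈ range (n + 1), theta a b r * (invPoch (a * b) (n - r) * invPoch (a * b) (n + r)) := by
    intro n
    rw [Finset.Nat.sum_antidiagonal_eq_sum_range_succ_mk]
    refine sum_congr rfl fun r hr => ?_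
    have := mem_range.1 hr
    simp only [show 2 * r + (n - r) = n + r by omega]
  induction n with
  | zero => simp [theta, invPoch_zero, qPoch_zero]
  | succ n ih =>
    rw [conv] at ih ⊢
    have h1 := sum_theta_partial hp n 0
    have h2 : ∀ i : ℕ, 1 - (a * b) ^ (i + 1) ≠ 0 := fun i => by
      rw [pow_succ']; exact sub_ne_zero.2 (self_pow_ne_one hp i).symm
    have h3 := h2 (2 * n)
    have h4 := h2 (2 * n + 1)
    apply mul_left_cancel₀ (mul_ne_zero h3 h4)
    have h6 : ∑ r ∈ range (n + 1), theta a b r * ((1 + a * (a * b) ^ n) * (1 + b * (a * b) ^ n) *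
        (invPoch (a * b) (n - r) * invPoch (a * b) (n + r))) =
        (1 + a * (a * b) ^ n) * (1 + b * (a * b) ^ n) *
          (qPoch (-a) (a * b) n * qPoch (-b) (a * b) n * invPoch (a * b) (2 * n)) := by
      rw [← ih, mul_sum]
      exact sum_congr rfl fun _ _ => by ring
    rw [sum_congr rfl fun r _ => mul_sub (theta a b r) _ _, sum_sub_distrib] at h1
    simp only [add_zero, h6] at h1
    rw [sum_range_succ, theta, if_neg (by omega), mul_add, mul_sum]
    rw [invPoch_eq hp (2 * n), invPoch_eq hp (2 * n + 1)] at h1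
    rw [invPoch_eq hp (n + 1 + n)] at h1
    simp only [Nat.sub_self, invPoch_zero, show 2 * (n + 1) = 2 * n + 1 + 1 by ring,
      show n + 1 + (n + 1) = n + 1 + n + 1 by ring, qPoch_succ] at h1 ⊢
    have h5 : ∀ r, (1 - (a * b) ^ (2 * n + 1)) * (1 - (a * b) ^ (2 * n + 1 + 1)) *
        (theta a b r * (invPoch (a * b) (n + 1 - r) * invPoch (a * b) (n + 1 + r))) =
        theta a b r * ((1 - (a * b) ^ (2 * n + 1)) * (1 - (a * b) ^ (2 * n + 2)) *
        (invPoch (a * b) (n + 1 - r) * invPoch (a * b) (n + 1 + r))) := fun r => by ring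
    simp only [h5]
    have e2 : (n + 1 + 1).choose 2 = (n + 1).choose 2 + (n + 1) := by
      rw [Nat.choose_succ_succ' (n + 1) 1]; simp; ring
    have e1 : (n + 1).choose 2 = n.choose 2 + n := by
      rw [Nat.choose_succ_succ' n 1]; simp; ring
    rw [e2, e1]
    rw [e1] at h1
    linear_combination h1

theorem choose_succ_two (r : ℕ) : (r + 1).choose 2 = r.choose 2 + r := by
  rw [Nat.choose_succ_succ' r 1]; simp; ring

theorem summable_norm_theta {a b : ℂ} (ha : ‖a‖ < 1) (hb : ‖b‖ < 1) :
    Summable fun r => ‖theta a b r‖ := by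
  refine Summable.of_nonneg_of_le (fun _ => norm_nonneg _) (fun r => ?_)
    ((summable_geometric_of_lt_one (norm_nonneg _) ha).add
      (summable_geometric_of_lt_one (norm_nonneg _) hb))
  have key : ∀ {x y : ℂ}, ‖x‖ < 1 → ‖y‖ < 1 →
      ‖x ^ (r + 1).choose 2 * y ^ r.choose 2‖ ≤ ‖x‖ ^ r := fun {x y} hx hy => by
    rw [norm_mul, norm_pow, norm_pow, choose_succ_two]
    exact (mul_le_of_le_one_right (by positivity) (pow_le_one₀ (norm_nonneg _) hy.le)).trans
      (pow_le_pow_of_le_one (norm_nonneg _) hx.le (Nat.le_add_left _ _))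
  rcases Nat.eq_zero_or_pos r with rfl | hr
  · simp [theta]
  · rw [theta, if_neg hr.ne']
    exact (norm_add_le _ _).trans (add_le_add (key ha hb) (key hb ha))

/-- The Jacobi triple product identity. -/
theorem hasSum_theta {a b : ℂ} (ha : ‖a‖ < 1) (hb : ‖b‖ < 1) :
    HasSum (theta a b)
      (qPochInf (a * b) (a * b) * qPochInf (-a) (a * b) * qPochInf (-b) (a * b)) := by
  have hp : ‖a * b‖ < 1 := by rw [norm_mul]; nlinarith [norm_nonneg a, norm_nonneg b]
  obtain ⟨C, hC0, hC⟩ := exists_norm_invPoch_le hp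
  have hI := tendsto_invPoch hp
  set I := (qPochInf (a * b) (a * b))⁻¹
  have hI0 : qPochInf (a * b) (a * b) ≠ 0 := qPochInf_ne_zero hp (self_pow_ne_one hp)
  -- Extension by zero turns the finite identities into full series in `r`, so that dominated
  -- convergence applies with `theta` as majorant up to a constant.
  let f : ℕ → ℕ → ℂ := fun n r =>
    if r ≤ n then theta a b r * (invPoch (a * b) (n - r) * invPoch (a * b) (n + r)) else 0
  have hf : ∀ n, ∑' r, f n r =
      qPoch (-a) (a * b) n * qPoch (-b) (a * b) n * invPoch (a * b) (2 * n) := fun n => by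
    rw [tsum_eq_sum (s := range (n + 1)) (fun r hr => if_neg (by simpa using hr)),
      ← sum_antidiagonal_theta hp, Finset.Nat.sum_antidiagonal_eq_sum_range_succ_mk]
    refine sum_congr rfl fun r hr => ?_
    have := mem_range.1 hr
    simp only [if_pos (show r ≤ n by omega), show 2 * r + (n - r) = n + r by omega]
  have h1 : Tendsto (fun n => ∑' r, f n r) atTop (𝓝 (∑' r, theta a b r * (I * I))) := by
    refine tendsto_tsum_of_dominated_convergence
      ((summable_norm_theta ha hb).mul_right (C * C)) (fun r => ?_)
      (Eventually.of_forall fun n r => ?_)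
    · have : Tendsto (fun n => theta a b r * (invPoch (a * b) (n - r) * invPoch (a * b) (n + r)))
          atTop (𝓝 (theta a b r * (I * I))) :=
        ((hI.comp (tendsto_sub_atTop_nat r)).mul
          (hI.comp (tendsto_add_atTop_nat r))).const_mul _
      refine this.congr' ?_
      filter_upwards [eventually_ge_atTop r] with n hn
      simp only [f, if_pos hn]
    · by_cases h : r ≤ n
      · simp only [f, if_pos h, norm_mul]
        have := hC (n - r)
        have := hC (n + r)
        gcongr
      · simp only [f, if_neg h, norm_zero]
        positivity
  simp only [hf] at h1
  have h2 := ((tendsto_qPoch (-a) hp).mul (tendsto_qPoch (-b) hp)).mul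
    (hI.comp (tendsto_id.const_mul_atTop' (show 0 < 2 by norm_num)))
  have h3 := tendsto_nhds_unique h1 h2
  have hS := (summable_norm_theta ha hb).of_norm
  rw [tsum_mul_right] at h3
  have h4 : ∑' r, theta a b r =
      qPochInf (a * b) (a * b) * qPochInf (-a) (a * b) * qPochInf (-b) (a * b) := by
    have hII : I * qPochInf (a * b) (a * b) = 1 := inv_mul_cancel₀ hI0
    linear_combination (qPochInf (a * b) (a * b)) ^ 2 * h3 -
      (∑' r, theta a b r) * (I * qPochInf (a * b) (a * b) + 1) * hII +
      qPochInf (-a) (a * b) * qPochInf (-b) (a * b) * qPochInf (a * b) (a * b) * hII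
  rw [← h4]
  exact hS.hasSum

/-! ### Double series and auxiliary bounds -/

theorem hasSum_sum_antidiagonal {f : ℕ × ℕ → ℂ} (hf : Summable f) :
    HasSum (fun n => ∑ x ∈ antidiagonal n, f x) (∑' x, f x) := by
  have h := (HasAntidiagonal.sigmaAntidiagonalEquivProd (A := ℕ)).hasSum_iff.2 hf.hasSum
  refine h.sigma fun n => ?_
  have := hasSum_fintype fun c : antidiagonal n => f c
  rwa [sum_coe_sort (antidiagonal n) f] at this

/-- Each inner sum is a tail of `∑ v`, hence at most the whole of it. This justifies every exchange
of summations in the Bailey chain. -/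
theorem summable_mul_shift {ι : Type*} {u : ι → ℝ} {v : ℕ → ℝ} (hu0 : ∀ i, 0 ≤ u i)
    (hv0 : ∀ n, 0 ≤ v n) (hu : Summable u) (hv : Summable v) (g : ι → ℕ) :
    Summable fun x : ι × ℕ => u x.1 * v (g x.1 + x.2) := by
  have hinj : ∀ n, Function.Injective fun m : ℕ => n + m := fun n => add_right_injective n
  have hs : ∀ n, Summable fun m => v (n + m) := fun n => hv.comp_injective (hinj n)
  have hle : ∀ n, ∑' m, v (n + m) ≤ ∑' m, v m := fun n =>
    Summable.tsum_le_tsum_of_inj (fun m => n + m) (hinj n) (fun c _ => hv0 c)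
      (fun _ => le_rfl) (hs n) hv
  refine (summable_prod_of_nonneg fun x => mul_nonneg (hu0 x.1) (hv0 _)).2
    ⟨fun i => (hs (g i)).mul_left (u i), ?_⟩
  refine Summable.of_nonneg_of_le (fun i => tsum_nonneg fun m => mul_nonneg (hu0 i) (hv0 _))
    (fun i => ?_) (hu.mul_right (∑' n, v n))
  change ∑' m, u i * v (g i + m) ≤ _
  rw [tsum_mul_left]
  exact mul_le_mul_of_nonneg_left (hle _) (hu0 i)

theorem summable_norm_pow_sq {p : ℂ} (hp : ‖p‖ < 1) : Summable fun n : ℕ => ‖p ^ (n ^ 2)‖ := by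
  refine Summable.of_nonneg_of_le (fun _ => norm_nonneg _) (fun n => ?_)
    (summable_geometric_of_lt_one (norm_nonneg _) hp)
  rw [norm_pow]
  exact pow_le_pow_of_le_one (norm_nonneg _) hp.le (Nat.le_self_pow two_ne_zero n)

theorem sq_eq_choose (r : ℕ) : r ^ 2 = 2 * r.choose 2 + r := by
  induction r with
  | zero => simp
  | succ n ih => rw [choose_succ_two]; linarith [ih, add_sq n 1]

theorem seed_eq (q : ℂ) {r : ℕ} (hr : r ≠ 0) :
    seed q r = q ^ (4 * r.choose 2 + r) * (1 + (q ^ 2) ^ r) := by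
  have h := sq_eq_choose r
  rw [seed, if_neg hr, h, show 2 * (2 * r.choose 2 + r) - r = 4 * r.choose 2 + r by omega]
  ring

theorem summable_norm_seed {q : ℂ} (hq : ‖q‖ < 1) : Summable fun r => ‖seed q r‖ := by
  have h := summable_geometric_of_lt_one (norm_nonneg _) hq
  refine Summable.of_nonneg_of_le (fun _ => norm_nonneg _) (fun r => ?_) (h.add h)
  rcases Nat.eq_zero_or_pos r with rfl | hr
  · simp [seed]
  · rw [seed, if_neg hr.ne']
    have : r ≤ r ^ 2 := Nat.le_self_pow two_ne_zero r
    refine (norm_add_le _ _).trans (add_le_add ?_ ?_) <;>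
    · rw [norm_pow]
      exact pow_le_pow_of_le_one (norm_nonneg _) hq.le (by omega)

theorem qPoch_split (a q : ℂ) (n : ℕ) :
    qPoch a q (2 * n) = qPoch a (q ^ 2) n * qPoch (a * q) (q ^ 2) n := by
  induction n with
  | zero => simp [qPoch_zero]
  | succ n ih =>
    rw [show 2 * (n + 1) = 2 * n + 1 + 1 by ring]
    simp only [qPoch_succ, ih]
    ring

theorem qPoch_mul_qPoch_sq (q : ℂ) (n : ℕ) :
    qPoch q (q ^ 2) n * qPoch (q ^ 2) (q ^ 2) n = qPoch q q (2 * n) := by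
  rw [qPoch_split, ← sq]

/-! ### Building partitions by adding a largest part -/

namespace BddPartition

variable {k : ℕ}

/-- Partitions with at most one part are natural numbers. -/
def equivNat : ℕ ≃ BddPartition 1 where
  toFun n := ⟨fun i => if i = 0 then n else 0, fun i j h => by dsimp only; split_ifs <;> omega,
    fun i h => if_neg (by omega)⟩
  invFun l := l.first
  left_inv n := by simp [first, part]
  right_inv l := by
    refine Subtype.ext (funext fun i => ?_)
    dsimp only
    split_ifs with h
    · rw [h]; rfl
    · exact (l.2.2 i (by omega)).symm

/-- Add a new largest part, which exceeds the previous one by `j`. -/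
def cons (l : BddPartition (k + 1)) (j : ℕ) : BddPartition (k + 2) :=
  ⟨fun i => Nat.casesOn i (l.first + j) l.part, antitone_nat_of_succ_le fun n => by
    cases n with
    | zero => exact Nat.le_add_right _ _
    | succ n => exact l.2.1 (Nat.le_succ n), fun i h => by
    cases i with
    | zero => omega
    | succ i => exact l.2.2 i (by omega)⟩

/-- Remove the largest part. -/
def tail (l : BddPartition (k + 2)) : BddPartition (k + 1) :=
  ⟨fun i => l.part (i + 1), fun _ _ h => l.2.1 (Nat.succ_le_succ h),
    fun i h => l.2.2 (i + 1) (by omega)⟩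

theorem part_cons_succ (l : BddPartition (k + 1)) (j i : ℕ) :
    (l.cons j).part (i + 1) = l.part i := rfl

/-- Partitions are determined by the excess of the largest part and the remaining parts. -/
def equivCons : BddPartition (k + 1) × ℕ ≃ BddPartition (k + 2) where
  toFun x := x.1.cons x.2
  invFun l := (l.tail, l.part 0 - l.part 1)
  left_inv x := by
    refine Prod.ext rfl ?_
    change x.1.first + x.2 - x.1.first = x.2
    omega
  right_inv l := by
    refine Subtype.ext (funext fun i => ?_)
    cases i with
    | zero => exact Nat.add_sub_cancel' (l.2.1 (Nat.zero_le 1))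
    | succ i => rfl

/-- The summand attached to a partition, without the contribution of the largest part. -/
noncomputable def tailTerm (q : ℂ) (l : BddPartition (k + 1)) : ℂ :=
  q ^ (2 * ∑ i ∈ range k, l.part (i + 1) ^ 2) / l.denom q

theorem n₂_eq (l : BddPartition (k + 1)) :
    l.n₂ = ∑ i ∈ range k, l.part (i + 1) ^ 2 + l.first ^ 2 := by
  rw [n₂, sum_range_succ']; rfl

theorem denom_cons (q : ℂ) (l : BddPartition (k + 1)) (j : ℕ) :
    (l.cons j).denom q = l.denom q * qPoch (q ^ 2) (q ^ 2) j := by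
  have h1 : (l.cons j).last = l.last := rfl
  have h2 : (l.cons j).part 0 - (l.cons j).part (0 + 1) = j := Nat.add_sub_cancel_left _ _
  simp only [denom, poch, h1]
  rw [prod_range_succ', h2]
  simp only [part_cons_succ]
  ring

/-- The former largest part now counts among the lower ones, so its square appears; this is the
Gaussian factor of the Bailey step. -/
theorem tailTerm_cons (q : ℂ) (l : BddPartition (k + 1)) (j : ℕ) :
    (l.cons j).tailTerm q = invPoch (q ^ 2) j * ((q ^ 2) ^ (l.first ^ 2) * l.tailTerm q) := by
  have h : ∑ i ∈ range (k + 1), (l.cons j).part (i + 1) ^ 2 =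
      ∑ i ∈ range k, l.part (i + 1) ^ 2 + l.first ^ 2 := by
    rw [← n₂_eq]; rfl
  rw [tailTerm, h, denom_cons, tailTerm, invPoch, mul_add, pow_add, ← pow_mul]
  field_simp

theorem tailTerm_equivNat (q : ℂ) (n : ℕ) : (equivNat n).tailTerm q = invPoch q (2 * n) := by
  have h : (equivNat n).last = n := rfl
  have h2 : (equivNat n).part 0 - (equivNat n).part 1 = n := rfl
  simp [tailTerm, denom, poch, h, h2, qPoch_mul_qPoch_sq, invPoch]

theorem first_equivNat (n : ℕ) : (equivNat n).first = n := rfl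

theorem first_equivCons (x : BddPartition (k + 1) × ℕ) :
    (equivCons x).first = x.1.first + x.2 := rfl

theorem tailTerm_equivCons (q : ℂ) (x : BddPartition (k + 1) × ℕ) :
    (equivCons x).tailTerm q =
      invPoch (q ^ 2) x.2 * ((q ^ 2) ^ (x.1.first ^ 2) * x.1.tailTerm q) :=
  tailTerm_cons q x.1 x.2

end BddPartition

open BddPartition

/-! ### The Bailey chain -/

theorem hasSum_tailTerm_one {q : ℂ} (hq : ‖q‖ < 1) {w γ : ℕ → ℂ} (hw : Summable fun n => ‖w n‖)
    (hγ : ∀ r, HasSum (fun m => w (r + m) *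
      (invPoch (q ^ 2) m * invPoch (q ^ 2) (2 * r + m))) (γ r)) :
    ∀ S, HasSum (fun r => seed q r * γ r) S →
      HasSum (fun l : BddPartition 1 => w l.first * l.tailTerm q) S := by
  have hp := norm_pow_succ_lt hq two_ne_zero
  obtain ⟨C, hC0, hC⟩ := exists_norm_invPoch_le hp
  intro S hS
  let f : ℕ × ℕ → ℂ := fun x => seed q x.1 *
    (w (x.1 + x.2) * (invPoch (q ^ 2) x.2 * invPoch (q ^ 2) (2 * x.1 + x.2)))
  have hf : Summable f := by
    refine Summable.of_norm_bounded ((summable_mul_shift (fun _ => norm_nonneg _)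
      (fun _ => norm_nonneg _) (summable_norm_seed hq) hw id).mul_right (C * C)) fun x => ?_
    simp only [f, norm_mul, id, ← mul_assoc]
    have := hC x.2
    have := hC (2 * x.1 + x.2)
    gcongr
  have h1 := hf.hasSum.prod_fiberwise fun r => (hγ r).mul_left (seed q r)
  rw [hS.unique h1, ← equivNat.hasSum_iff]
  refine (hasSum_sum_antidiagonal hf).congr_fun fun n => ?_
  simp only [Function.comp_apply, first_equivNat, tailTerm_equivNat]
  rw [← sum_antidiagonal_seed hq, mul_sum]
  refine sum_congr rfl fun x hx => ?_
  simp only [f, mem_antidiagonal.1 hx]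
  ring

/-- Here `v` is what remains of the weight after summing over the excess `j` of the largest part.
Since (r+x)² = r² + x(x+2r), grouping the double sum by diagonals leaves a q-Vandermonde sum with `s
= 2 * r`, and p^(r²) factors out. -/
theorem bailey_step {q : ℂ} (hq : ‖q‖ < 1) {w γ : ℕ → ℂ} (hw : Summable fun n => ‖w n‖)
    (hγ : ∀ r, HasSum (fun m => w (r + m) *
      (invPoch (q ^ 2) m * invPoch (q ^ 2) (2 * r + m))) (γ r)) :
    ∃ v : ℕ → ℂ, (Summable fun n => ‖v n‖) ∧
      (∀ m, HasSum (fun j => w (m + j) * invPoch (q ^ 2) j * (q ^ 2) ^ m ^ 2) (v m)) ∧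
      ∀ r, HasSum (fun m => v (r + m) *
        (invPoch (q ^ 2) m * invPoch (q ^ 2) (2 * r + m))) ((q ^ 2) ^ r ^ 2 * γ r) := by
  have hp := norm_pow_succ_lt hq two_ne_zero
  obtain ⟨C, hC0, hC⟩ := exists_norm_invPoch_le hp
  have hw' : Summable fun x : ℕ × ℕ =>
      ‖w (x.1 + x.2) * invPoch (q ^ 2) x.2 * (q ^ 2) ^ x.1 ^ 2‖ := by
    refine Summable.of_nonneg_of_le (fun _ => norm_nonneg _) (fun x => ?_)
      ((summable_mul_shift (fun _ => norm_nonneg _) (fun _ => norm_nonneg _)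
        (summable_norm_pow_sq hp) hw id).mul_right C)
    rw [norm_mul, norm_mul, mul_comm, ← mul_assoc]
    have := hC x.2
    simp only [id]
    gcongr
  have hv := hw'.of_norm.prod_factor
  refine ⟨fun m => ∑' j, w (m + j) * invPoch (q ^ 2) j * (q ^ 2) ^ m ^ 2, ?_,
    fun m => (hv m).hasSum, fun r => ?_⟩
  · refine Summable.of_nonneg_of_le (fun _ => norm_nonneg _) (fun m => ?_) hw'.prod
    exact norm_tsum_le_tsum_norm (hw'.prod_factor m)
  · let f : ℕ × ℕ → ℂ := fun x => w (r + x.1 + x.2) * invPoch (q ^ 2) x.2 *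
      (q ^ 2) ^ (r + x.1) ^ 2 * (invPoch (q ^ 2) x.1 * invPoch (q ^ 2) (2 * r + x.1))
    have hf : Summable f := by
      have hinj : Function.Injective fun x : ℕ × ℕ => (r + x.1, x.2) := fun x y h => by
        simp only [Prod.mk.injEq, Nat.add_left_cancel_iff] at h
        exact Prod.ext h.1 h.2
      refine Summable.of_norm_bounded ((hw'.comp_injective hinj).mul_right (C * C)) fun x => ?_
      simp only [f, Function.comp_apply]
      rw [norm_mul, norm_mul (invPoch (q ^ 2) x.1)]
      have := hC x.1
      have := hC (2 * r + x.1)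
      gcongr
    have h1 := hf.hasSum.prod_fiberwise fun m => (hv (r + m)).hasSum.mul_right
      (invPoch (q ^ 2) m * invPoch (q ^ 2) (2 * r + m))
    have h2 := (hγ r).mul_left ((q ^ 2) ^ r ^ 2)
    have h3 := hasSum_sum_antidiagonal hf
    have h4 : (fun n => ∑ x ∈ antidiagonal n, f x) = fun n => (q ^ 2) ^ r ^ 2 * (w (r + n) *
        (invPoch (q ^ 2) n * invPoch (q ^ 2) (2 * r + n))) := by
      funext n
      rw [← sum_antidiagonal_vandermonde hp, mul_sum, mul_sum]
      refine sum_congr rfl fun x hx => ?_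
      simp only [f, ← mem_antidiagonal.1 hx, add_assoc]
      ring
    rw [h4] at h3
    rw [h2.unique h3]
    exact h1

theorem summable_tailTerm {q : ℂ} (hq : ‖q‖ < 1) (k : ℕ) {w : ℕ → ℂ}
    (hw : Summable fun n => ‖w n‖) :
    Summable fun l : BddPartition (k + 1) => ‖w l.first * l.tailTerm q‖ := by
  have hp := norm_pow_succ_lt hq two_ne_zero
  obtain ⟨C, hC0, hC⟩ := exists_norm_invPoch_le hp
  induction k generalizing w with
  | zero =>
    obtain ⟨D, hD0, hD⟩ := exists_norm_invPoch_le hq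
    rw [← equivNat.summable_iff]
    refine Summable.of_nonneg_of_le (fun _ => norm_nonneg _) (fun n => ?_) (hw.mul_right D)
    simp only [Function.comp_apply, first_equivNat, tailTerm_equivNat, norm_mul]
    have := hD (2 * n)
    gcongr
  | succ k ih =>
    rw [← equivCons.summable_iff]
    refine Summable.of_nonneg_of_le (fun _ => norm_nonneg _) (fun x => ?_)
      ((summable_mul_shift (fun _ => norm_nonneg _) (fun _ => norm_nonneg _)
        (ih (summable_norm_pow_sq hp)) hw first).mul_right C)
    simp only [Function.comp_apply, first_equivCons, tailTerm_equivCons, norm_mul]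
    have := hC x.2
    calc _ ≤ ‖w (x.1.first + x.2)‖ * (C * (‖(q ^ 2) ^ x.1.first ^ 2‖ * ‖tailTerm q x.1‖)) := by
          gcongr
      _ = _ := by ring

/-- Sums over partitions with at most `k + 1` parts, by iterating the Bailey lemma. -/
theorem hasSum_tailTerm {q : ℂ} (hq : ‖q‖ < 1) (k : ℕ) {w γ : ℕ → ℂ}
    (hw : Summable fun n => ‖w n‖)
    (hγ : ∀ r, HasSum (fun m => w (r + m) *
      (invPoch (q ^ 2) m * invPoch (q ^ 2) (2 * r + m))) (γ r)) {S : ℂ}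
    (hS : HasSum (fun r => seed q r * ((q ^ 2) ^ (k * r ^ 2) * γ r)) S) :
    HasSum (fun l : BddPartition (k + 1) => w l.first * l.tailTerm q) S := by
  induction k generalizing w γ with
  | zero => exact hasSum_tailTerm_one hq hw hγ S (by simpa using hS)
  | succ k ih =>
    obtain ⟨v, hv, hvw, hvγ⟩ := bailey_step hq hw hγ
    have h1 := ih hv hvγ (by convert hS using 3 with r; ring)
    have hsum := equivCons.summable_iff.2 (summable_tailTerm hq (k + 1) hw).of_norm
    -- Absolute convergence lets the sum be taken first over the excess of the largest part, which
    -- leaves the weight `v` on partitions with one part fewer.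
    have h2 := hsum.hasSum.prod_fiberwise (g := fun l => v l.first * l.tailTerm q) fun l => by
      refine ((hvw l.first).mul_right (l.tailTerm q)).congr_fun fun j => ?_
      simp only [Function.comp_apply, first_equivCons, tailTerm_equivCons]
      ring
    rw [← equivCons.hasSum_iff, h1.unique h2]
    exact hsum.hasSum

theorem hasSum_of_eq {ι : Type*} {f g : ι → ℂ} {a b : ℂ} (h : HasSum g b) (hf : ∀ i, f i = g i)
    (ha : a = b) : HasSum f a := by
  rw [ha, funext hf]; exact h

/-! ### Evaluating γ by the q-Gauss sum -/

theorem invPoch_add {p : ℂ} (n m : ℕ) :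
    invPoch p (n + m) = invPoch p n * (qPoch (p * p ^ n) p m)⁻¹ := by
  rw [invPoch, qPoch_add, mul_inv, invPoch]

theorem qPochInf_eq_shift {p : ℂ} (hp : ‖p‖ < 1) (n : ℕ) :
    (qPochInf (p * p ^ n) p)⁻¹ = (qPochInf p p)⁻¹ * qPoch p p n := by
  have := qPoch_ne_zero (self_pow_ne_one hp) n
  rw [qPochInf_shift p hp n, mul_inv]
  field_simp

/-- The value of the `q`-Gauss sum attached to the index `r` of a Bailey pair. -/
noncomputable def gaussValue (A s B t d p : ℂ) (r : ℕ) : ℂ :=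
  weight A s B t d p r * (qPochInf (t * d * A * p ^ r) p * qPochInf (s * d * B * p ^ r) p /
    (qPochInf p p * qPochInf (d * A * B) p))

/-- Starting the weight at `r` replaces `s`, `t` by `s * p ^ r`, `t * p ^ r`. The hypothesis `hc`
makes the lower q-Gauss parameter `p ^ (c + 1)`, so that its shifted factorial completes (p;p)_c to
(p;p)_{c+m}. The case std = p gives `c = 2 * r`. -/
theorem hasSum_weight {A s B t d p : ℂ} (hp : ‖p‖ < 1) (h : ‖d * A * B‖ < 1) {r c : ℕ}
    (hc : s * t * d * p ^ (2 * r) = p ^ (c + 1)) :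
    HasSum (fun m => weight A s B t d p (r + m) * (invPoch p m * invPoch p (c + m)))
      (gaussValue A s B t d p r) := by
  have e : s * p ^ r * (t * p ^ r) * d = p * p ^ c := by rw [← pow_succ', ← hc]; ring
  have h1 := hasSum_gaussTerm (A := A) (B := B) (s := s * p ^ r) (t := t * p ^ r) hp h
    (fun i => by
      rw [e, mul_assoc, ← pow_add]; exact self_pow_ne_one hp _)
  have h2 := h1.mul_left (weight A s B t d p r * invPoch p c)
  have hi : qPoch p p c ≠ 0 := qPoch_ne_zero (self_pow_ne_one hp) c
  refine hasSum_of_eq h2 (fun m => ?_) ?_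
  · rw [gaussTerm, e, weight_add, invPoch_add]; ring
  · rw [e, gaussValue, div_eq_mul_inv _ (qPochInf (p * p ^ c) p * _), mul_inv,
      qPochInf_eq_shift hp, show t * p ^ r * d * A = t * d * A * p ^ r by ring,
      show s * p ^ r * d * B = s * d * B * p ^ r by ring, invPoch]
    field_simp

theorem hasSum_weight_one_sub {A s B t d p : ℂ} (hp : ‖p‖ < 1) (h : ‖d * A * B‖ < 1)
    (hc : s * t * d = 1) (r : ℕ) :
    HasSum (fun m => weight A s B t d p (r + m) * ((1 - p ^ (2 * r + m)) *
      (invPoch p m * invPoch p (2 * r + m)))) (gaussValue A s B t d p r) := by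
  cases r with
  | succ r =>
    have h1 := hasSum_weight (r := r + 1) (c := 2 * r + 1) hp h (by rw [hc, one_mul]; rfl)
    refine hasSum_of_eq h1 (fun m => ?_) rfl
    rw [invPoch_eq hp (2 * r + 1 + m), show 2 * r + 1 + m + 1 = 2 * (r + 1) + m by ring]
    ring
  -- For `r = 0` the index `c = 2 * r - 1` would be negative. The term `m = 0` vanishes, and
  -- dropping it shifts `s` and `t` by `p`, giving `c = 1`.
  | zero =>
    have h1 := hasSum_weight (s := s * p) (t := t * p) (r := 0) (c := 1) hp h
      (by linear_combination p ^ 2 * hc)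
    have h2 := h1.mul_left (weight A s B t d p 1)
    rw [← hasSum_nat_add_iff' 1]
    refine hasSum_of_eq h2 (fun m => ?_) ?_
    · rw [show 0 + (m + 1) = 1 + m by ring, weight_add, invPoch_eq hp m, zero_add, pow_one,
        add_comm 1 m]
      ring
    · have e1 := qPochInf_shift (t * d * A) hp 1
      have e2 := qPochInf_shift (s * d * B) hp 1
      simp only [qPoch_succ, qPoch_zero, pow_zero, pow_one, mul_one, one_mul] at e1 e2
      simp only [sum_range_one, gaussValue, weight_zero, weight_succ _ _ _ _ _ _ 0, pow_zero,
        mul_zero, add_zero, sub_self, zero_mul, sub_zero, one_mul, mul_one, e1, e2]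
      rw [show t * p * d * A = t * d * A * p by ring, show s * p * d * B = s * d * B * p by ring]
      have e3 : (1 - t * d * A) * (1 - s * d * B) = (A - s) * (B - t) * d := by
        linear_combination (d * A * B - 1) * hc
      rw [← e3]; ring

theorem hasSum_weight_one_sub' {A s B t d p : ℂ} (hp : ‖p‖ < 1) (h : ‖d * A * B‖ < 1)
    (hc : s * t * d = 1) (r : ℕ) :
    HasSum (fun m => weight A s B t d p (r + m) * (1 - p ^ (r + m)) *
      (invPoch p m * invPoch p (2 * r + m)))
      (gaussValue A s B t d p r + (p ^ r - 1) * gaussValue A s B t (d * p) p r) := by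
  have h' : ‖d * p * A * B‖ < 1 := by
    rw [show d * p * A * B = p * (d * A * B) by ring, norm_mul]
    nlinarith [norm_nonneg p, norm_nonneg (d * A * B)]
  have h1 := hasSum_weight_one_sub hp h hc r
  have h2 := hasSum_weight (r := r) (c := 2 * r) (s := s) (t := t) hp h'
    (by linear_combination p * p ^ (2 * r) * hc)
  -- 1 - p^(r+m) = (1 - p^(2r+m)) + (p^r - 1) p^(r+m), where p^(r+m) is absorbed by passing from `d`
  -- to `d * p`.
  refine hasSum_of_eq (h1.add (h2.mul_left (p ^ r - 1))) (fun m => ?_) rfl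
  rw [weight_mul]; ring

theorem summable_norm_weight_one_sub (A s B t d : ℂ) {p : ℂ} (hp : ‖p‖ < 1)
    (h : ‖d * A * B‖ < 1) :
    Summable fun n => ‖weight A s B t d p n * (1 - p ^ n)‖ := by
  refine Summable.of_nonneg_of_le (fun _ => norm_nonneg _) (fun n => ?_)
    ((summable_norm_weight A s B t d hp h).mul_right 2)
  rw [norm_mul]
  refine mul_le_mul_of_nonneg_left ((norm_sub_le _ _).trans ?_) (norm_nonneg _)
  rw [norm_one, norm_pow]
  have := pow_le_one₀ (n := n) (norm_nonneg p) hp.le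
  linarith

/-! ### Specialized weights -/

theorem shiftProd_one (s p : ℂ) (n : ℕ) : shiftProd 1 s p n = qPoch s p n := rfl

theorem shiftProd_zero_left (s p : ℂ) (n : ℕ) :
    shiftProd 0 s p n = (-s) ^ n * p ^ n.choose 2 := by
  induction n with
  | zero => simp [shiftProd]
  | succ n ih => rw [shiftProd_succ, ih, choose_succ_two]; ring

theorem weight_zero_zero (d p : ℂ) (n : ℕ) :
    weight 0 1 0 1 d p n = (p ^ n.choose 2) ^ 2 * d ^ n := by
  have : ((-1 : ℂ) ^ n) ^ 2 = 1 := by rw [← pow_mul, mul_comm, pow_mul]; norm_num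
  rw [weight, shiftProd_zero_left]
  linear_combination (p ^ n.choose 2) ^ 2 * d ^ n * this

theorem weight_one_zero (s d p : ℂ) (n : ℕ) :
    weight 1 s 0 (-1) d p n = qPoch s p n * p ^ n.choose 2 * d ^ n := by
  rw [weight, shiftProd_zero_left, shiftProd_one]; simp

theorem weight_one_one (s t d p : ℂ) (n : ℕ) :
    weight 1 s 1 t d p n = qPoch s p n * qPoch t p n * d ^ n := rfl

theorem gaussValue_zero_zero (d p : ℂ) (r : ℕ) :
    gaussValue 0 1 0 1 d p r = (p ^ r.choose 2) ^ 2 * d ^ r * (qPochInf p p)⁻¹ := by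
  simp [gaussValue, weight_zero_zero, qPochInf_zero]

theorem gaussValue_one_zero (s d p : ℂ) (r : ℕ) :
    gaussValue 1 s 0 (-1) d p r =
      p ^ r.choose 2 * d ^ r * (qPoch s p r * qPochInf (-d * p ^ r) p) * (qPochInf p p)⁻¹ := by
  simp only [gaussValue, weight_one_zero, qPochInf_zero, mul_zero, zero_mul, mul_one, neg_one_mul]
  ring

theorem gaussValue_one_one (s t d p : ℂ) (r : ℕ) :
    gaussValue 1 s 1 t d p r = d ^ r * (qPoch s p r * qPochInf (t * d * p ^ r) p) *
      (qPoch t p r * qPochInf (s * d * p ^ r) p) / (qPochInf p p * qPochInf d p) := by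
  simp only [gaussValue, weight_one_one, mul_one]
  ring

theorem theta_eq (a b : ℂ) {r : ℕ} (hr : r ≠ 0) :
    theta a b r =
      a ^ (r.choose 2 + r) * b ^ r.choose 2 + b ^ (r.choose 2 + r) * a ^ r.choose 2 := by
  rw [theta, if_neg hr, choose_succ_two]

theorem qPoch_neg_one_mul (p : ℂ) (r : ℕ) :
    qPoch (-1) p r * (1 + p ^ r) = 2 * qPoch (-p) p r := by
  have h1 := qPoch_succ (-1) p r
  have h2 := qPoch_succ' (-1) p r
  rw [neg_one_mul] at h2
  linear_combination h2 - h1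

theorem qPoch_neg_one_mul_qPochInf {p : ℂ} (hp : ‖p‖ < 1) (r : ℕ) :
    qPoch (-1) p r * qPochInf (-p * p ^ r) p * (1 + p ^ r) = 2 * qPochInf (-p) p := by
  rw [qPochInf_shift (-p) hp r]
  linear_combination qPochInf (-p * p ^ r) p * qPoch_neg_one_mul p r

/-- Reduces each sum to a termwise comparison with a theta series. Exponents are written with
`r.choose 2`, using r² = 2·C(r,2) + r, so that no subtraction or halving occurs; `r = 0` is separate
because the folded sequences equal 1 there, not 2. -/
theorem hasSum_tailTerm_theta {q : ℂ} (hq : ‖q‖ < 1) (k : ℕ) {w γ : ℕ → ℂ}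
    (hw : Summable fun n => ‖w n‖)
    (hγ : ∀ r, HasSum (fun m => w (r + m) *
      (invPoch (q ^ 2) m * invPoch (q ^ 2) (2 * r + m))) (γ r))
    {a b P C : ℂ} (ha : ‖a‖ < 1) (hb : ‖b‖ < 1) (hab : a * b = P)
    (h0 : γ 0 = C)
    (h : ∀ r, r ≠ 0 → q ^ (4 * r.choose 2 + r) * (1 + (q ^ 2) ^ r) *
      ((q ^ 2) ^ (k * (2 * r.choose 2 + r)) * γ r) =
      (a ^ (r.choose 2 + r) * b ^ r.choose 2 + b ^ (r.choose 2 + r) * a ^ r.choose 2) * C) :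
    HasSum (fun l : BddPartition (k + 1) => w l.first * l.tailTerm q)
      (C * qPochInf₃ P (-b) (-a) P) := by
  refine hasSum_tailTerm hq k hw hγ ?_
  refine hasSum_of_eq ((hasSum_theta ha hb).mul_right C) (fun r => ?_) ?_
  · rcases Nat.eq_zero_or_pos r with rfl | hr
    · simp [seed, theta, h0]
    · rw [seed_eq q hr.ne', theta_eq a b hr.ne', sq_eq_choose, h r hr.ne']
  · rw [hab, qPochInf₃]; ring

/-! ### The six partition sums -/

theorem hasSum_pow_n₂ {q : ℂ} (hq : ‖q‖ < 1) (k : ℕ) :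
    HasSum (fun l : BddPartition (k + 1) => q ^ (2 * l.n₂) / l.denom q)
      ((qPochInf (q ^ 2) (q ^ 2))⁻¹ * qPochInf₃ (q ^ (4 * (k + 1) + 4)) (-q ^ (2 * (k + 1) + 1))
        (-q ^ (2 * (k + 1) + 3)) (q ^ (4 * (k + 1) + 4))) := by
  have hp := norm_pow_succ_lt hq two_ne_zero
  have h := hasSum_tailTerm_theta hq k (summable_norm_weight 0 1 0 1 (q ^ 2) hp (by simp))
    (fun r => hasSum_weight hp (by simp) (by ring))
    (a := q ^ (2 * (k + 1) + 3)) (b := q ^ (2 * (k + 1) + 1))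
    (norm_pow_succ_lt hq (by omega)) (norm_pow_succ_lt hq (by omega))
    (P := q ^ (4 * (k + 1) + 4)) (by ring)
    (C := (qPochInf (q ^ 2) (q ^ 2))⁻¹) (by simp [gaussValue_zero_zero])
    (fun r _ => by rw [gaussValue_zero_zero]; ring)
  refine hasSum_of_eq h (fun l => ?_) rfl
  rw [weight_zero_zero, tailTerm, n₂_eq, sq_eq_choose l.first]
  ring

theorem hasSum_pow_n₂_mul_one_sub {q : ℂ} (hq : ‖q‖ < 1) (k : ℕ) :
    HasSum (fun l : BddPartition (k + 1) =>
        q ^ (2 * l.n₂ - 2 * l.first) / l.denom q * (1 - q ^ (2 * l.first)))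
      ((qPochInf (q ^ 2) (q ^ 2))⁻¹ * qPochInf₃ (q ^ (4 * (k + 1) + 4)) (-q ^ (2 * (k + 1) - 1))
        (-q ^ (2 * (k + 1) + 5)) (q ^ (4 * (k + 1) + 4))) := by
  have hp := norm_pow_succ_lt hq two_ne_zero
  rw [show 2 * (k + 1) - 1 = 2 * k + 1 by omega]
  have h := hasSum_tailTerm_theta hq k (summable_norm_weight_one_sub 0 1 0 1 1 hp (by simp))
    (fun r => hasSum_weight_one_sub' hp (by simp) (by ring) r)
    (a := q ^ (2 * (k + 1) + 5)) (b := q ^ (2 * k + 1))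
    (norm_pow_succ_lt hq (by omega)) (norm_pow_succ_lt hq (by omega))
    (P := q ^ (4 * (k + 1) + 4)) (by ring)
    (C := (qPochInf (q ^ 2) (q ^ 2))⁻¹) (by simp [gaussValue_zero_zero])
    -- With `p = q ^ 2`, (1 + p^r)(p^(-r) - 1 + p^r) = p^(-r) + p^(2r): the linear exponents ±r of
    -- the seed become ±3r, whence a/b = q^6.
    (fun r _ => by rw [gaussValue_zero_zero, gaussValue_zero_zero, one_mul]; ring)
  refine hasSum_of_eq h (fun l => ?_) rfl
  rw [weight_zero_zero, tailTerm, n₂_eq, sq_eq_choose l.first, mul_add,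
    show ∀ x y z : ℕ, 2 * x + 2 * (2 * y + z) - 2 * z = 2 * x + 4 * y by omega]
  ring

theorem hasSum_mul_qPoch_neg_self {q : ℂ} (hq : ‖q‖ < 1) (k : ℕ) :
    HasSum (fun l : BddPartition (k + 1) =>
        q ^ (2 * l.n₂ - l.first ^ 2) / l.denom q * qPoch (-q) (q ^ 2) l.first)
      (qPochInf (-q) (q ^ 2) / qPochInf (q ^ 2) (q ^ 2) *
        qPochInf₃ (q ^ (4 * (k + 1) + 2)) (-q ^ (2 * (k + 1))) (-q ^ (2 * (k + 1) + 2))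
          (q ^ (4 * (k + 1) + 2))) := by
  have hp := norm_pow_succ_lt hq two_ne_zero
  have h := hasSum_tailTerm_theta hq k (summable_norm_weight 1 (-q) 0 (-1) q hp (by simp))
    (fun r => hasSum_weight hp (by simp) (by ring))
    (a := q ^ (2 * (k + 1) + 2)) (b := q ^ (2 * (k + 1)))
    (norm_pow_succ_lt hq (by omega)) (norm_pow_succ_lt hq (by omega))
    (P := q ^ (4 * (k + 1) + 2)) (by ring)
    (C := qPochInf (-q) (q ^ 2) / qPochInf (q ^ 2) (q ^ 2))
    (by rw [gaussValue_one_zero, ← qPochInf_shift _ hp]; simp [div_eq_mul_inv])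
    (fun r _ => by rw [gaussValue_one_zero, ← qPochInf_shift _ hp]; ring)
  refine hasSum_of_eq h (fun l => ?_) rfl
  rw [weight_one_zero, tailTerm, n₂_eq, sq_eq_choose l.first, mul_add,
    show ∀ x y z : ℕ, 2 * x + 2 * (2 * y + z) - (2 * y + z) = 2 * x + (2 * y + z) by omega]
  ring

theorem hasSum_mul_qPoch_neg_one_mul_one_sub {q : ℂ} (hq : ‖q‖ < 1) (k : ℕ) :
    HasSum (fun l : BddPartition (k + 1) =>
        q ^ (2 * l.n₂ - l.first ^ 2 - l.first) / l.denom q *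
          qPoch (-1) (q ^ 2) l.first * (1 - q ^ (2 * l.first)))
      (2 * (qPochInf (-q ^ 2) (q ^ 2) / qPochInf (q ^ 2) (q ^ 2)) *
        qPochInf₃ (q ^ (4 * (k + 1) + 2)) (-q ^ (2 * (k + 1) - 1)) (-q ^ (2 * (k + 1) + 3))
          (q ^ (4 * (k + 1) + 2))) := by
  have hp := norm_pow_succ_lt hq two_ne_zero
  rw [show 2 * (k + 1) - 1 = 2 * k + 1 by omega]
  have h2 : qPochInf (-1) (q ^ 2) = 2 * qPochInf (-q ^ 2) (q ^ 2) := by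
    rw [qPochInf_shift _ hp 1, qPoch_succ, qPoch_zero]; norm_num
  have h := hasSum_tailTerm_theta hq k (summable_norm_weight_one_sub 1 (-1) 0 (-1) 1 hp (by simp))
    (fun r => hasSum_weight_one_sub' hp (by simp) (by ring) r)
    (a := q ^ (2 * (k + 1) + 3)) (b := q ^ (2 * k + 1))
    (norm_pow_succ_lt hq (by omega)) (norm_pow_succ_lt hq (by omega))
    (P := q ^ (4 * (k + 1) + 2)) (by ring)
    (C := 2 * (qPochInf (-q ^ 2) (q ^ 2) / qPochInf (q ^ 2) (q ^ 2)))
    (by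
      rw [gaussValue_one_zero, ← qPochInf_shift _ hp, h2]; simp [div_eq_mul_inv, mul_assoc])
    (fun r _ => by
      rw [gaussValue_one_zero, gaussValue_one_zero, ← qPochInf_shift _ hp, h2, one_mul]
      -- With `p = q ^ 2`, this removes 1 + p^r from the second q-Gauss value; then (1 + p^r) + (p^r
      -- - 1) p^r = 1 + p^(2r) gives the two theta terms.
      have := qPoch_neg_one_mul_qPochInf hp r
      linear_combination q ^ (4 * r.choose 2 + r) * (q ^ 2) ^ (k * (2 * r.choose 2 + r)) *
        (((q ^ 2) ^ r - 1) * (q ^ 2) ^ (r.choose 2 + r)) * (qPochInf (q ^ 2) (q ^ 2))⁻¹ * this)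
  refine hasSum_of_eq h (fun l => ?_) rfl
  rw [weight_one_zero, tailTerm, n₂_eq, sq_eq_choose l.first, mul_add,
    show ∀ x y z : ℕ, 2 * x + 2 * (2 * y + z) - (2 * y + z) - z = 2 * x + 2 * y by omega]
  ring

theorem hasSum_mul_qPoch_neg_one_mul_qPoch_neg_self {q : ℂ} (hq : ‖q‖ < 1) (k : ℕ) :
    HasSum (fun l : BddPartition (k + 1) =>
        q ^ (2 * l.n₂ - 2 * l.first ^ 2 + l.first) / l.denom q *
          qPoch (-1) (q ^ 2) l.first * qPoch (-q) (q ^ 2) l.first)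
      (qPochInf (-q ^ 2) (q ^ 2) * qPochInf (-q) (q ^ 2) /
          (qPochInf (q ^ 2) (q ^ 2) * qPochInf q (q ^ 2)) *
        qPochInf₃ (q ^ (4 * (k + 1))) (-q ^ (2 * (k + 1))) (-q ^ (2 * (k + 1)))
          (q ^ (4 * (k + 1)))) := by
  have hp := norm_pow_succ_lt hq two_ne_zero
  have h := hasSum_tailTerm_theta hq k
    (summable_norm_weight 1 (-1) 1 (-q) q hp (by simpa using hq))
    (fun r => hasSum_weight hp (by simpa using hq) (by ring))
    (a := q ^ (2 * (k + 1))) (b := q ^ (2 * (k + 1)))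
    (norm_pow_succ_lt hq (by omega)) (norm_pow_succ_lt hq (by omega))
    (P := q ^ (4 * (k + 1))) (by ring)
    (C := qPochInf (-q ^ 2) (q ^ 2) * qPochInf (-q) (q ^ 2) /
          (qPochInf (q ^ 2) (q ^ 2) * qPochInf q (q ^ 2)))
    (by simp [gaussValue_one_one, qPoch_zero, ← sq])
    (fun r _ => by
      rw [gaussValue_one_one, neg_one_mul q, ← qPochInf_shift _ hp,
        show -q * q * (q ^ 2) ^ r = -q ^ 2 * (q ^ 2) ^ r by ring]
      -- The factor 1 + (q²)^r of the seed is absorbed, leaving two equal theta terms; hence `a =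
      -- b`.
      have := qPoch_neg_one_mul_qPochInf hp r
      linear_combination q ^ (4 * r.choose 2 + r) * (q ^ 2) ^ (k * (2 * r.choose 2 + r)) *
        q ^ r * qPochInf (-q) (q ^ 2) / (qPochInf (q ^ 2) (q ^ 2) * qPochInf q (q ^ 2)) * this)
  refine hasSum_of_eq h (fun l => ?_) rfl
  rw [weight_one_one, tailTerm, n₂_eq, mul_add, Nat.add_sub_cancel]
  ring

theorem hasSum_mul_qPoch_neg_one {q : ℂ} (hq : ‖q‖ < 1) (k : ℕ) :
    HasSum (fun l : BddPartition (k + 1) =>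
        q ^ (2 * l.n₂ - l.first ^ 2 + l.first) / l.denom q * qPoch (-1) (q ^ 2) l.first)
      (qPochInf (-q ^ 2) (q ^ 2) / qPochInf (q ^ 2) (q ^ 2) *
        qPochInf₃ (q ^ (4 * (k + 1) + 2)) (-q ^ (2 * (k + 1) + 1)) (-q ^ (2 * (k + 1) + 1))
          (q ^ (4 * (k + 1) + 2))) := by
  have hp := norm_pow_succ_lt hq two_ne_zero
  have h := hasSum_tailTerm_theta hq k (summable_norm_weight 1 (-1) 0 (-1) (q ^ 2) hp (by simp))
    (fun r => hasSum_weight hp (by simp) (by ring))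
    (a := q ^ (2 * (k + 1) + 1)) (b := q ^ (2 * (k + 1) + 1))
    (norm_pow_succ_lt hq (by omega)) (norm_pow_succ_lt hq (by omega))
    (P := q ^ (4 * (k + 1) + 2)) (by ring)
    (C := qPochInf (-q ^ 2) (q ^ 2) / qPochInf (q ^ 2) (q ^ 2))
    (by simp [gaussValue_one_zero, qPoch_zero, div_eq_mul_inv])
    (fun r _ => by
      rw [gaussValue_one_zero]
      have := qPoch_neg_one_mul_qPochInf hp r
      linear_combination q ^ (4 * r.choose 2 + r) * (q ^ 2) ^ (k * (2 * r.choose 2 + r)) *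
        (q ^ 2) ^ (r.choose 2 + r) * (qPochInf (q ^ 2) (q ^ 2))⁻¹ * this)
  refine hasSum_of_eq h (fun l => ?_) rfl
  rw [weight_one_zero, tailTerm, n₂_eq, sq_eq_choose l.first, mul_add,
    show ∀ x y z : ℕ, 2 * x + 2 * (2 * y + z) - (2 * y + z) + z = 2 * x + (2 * y + 2 * z) by omega]
  ring

/-! ### Infinite products over residue classes -/

theorem qPochInf_split (a : ℂ) {q : ℂ} (hq : ‖q‖ < 1) :
    qPochInf a q = qPochInf a (q ^ 2) * qPochInf (a * q) (q ^ 2) := by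
  have hp := norm_pow_succ_lt hq two_ne_zero
  have h1 := (tendsto_qPoch a hq).comp (tendsto_id.const_mul_atTop' (show 0 < 2 by norm_num))
  refine tendsto_nhds_unique h1 (((tendsto_qPoch a hp).mul (tendsto_qPoch (a * q) hp)).congr ?_)
  exact fun n => (qPoch_split a q n).symm

theorem qPochInf_sq (a : ℂ) {p : ℂ} (hp : ‖p‖ < 1) :
    qPochInf (a ^ 2) (p ^ 2) = qPochInf a p * qPochInf (-a) p := by
  rw [qPochInf, qPochInf, qPochInf,
    ← (multipliable_qPochInf a hp).tprod_mul (multipliable_qPochInf (-a) hp)]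
  exact tprod_congr fun i => by ring

theorem qPochInf_self_ne_zero {q : ℂ} (hq : ‖q‖ < 1) : qPochInf q q ≠ 0 :=
  qPochInf_ne_zero hq (self_pow_ne_one hq)

/-- Euler's identity between partitions into distinct and into odd parts. -/
theorem euler_distinct_odd {q : ℂ} (hq : ‖q‖ < 1) : qPochInf (-q) q * qPochInf q (q ^ 2) = 1 := by
  have h1 := qPochInf_split q hq
  have h2 := qPochInf_sq q hq
  rw [← sq] at h1
  apply mul_left_cancel₀ (qPochInf_self_ne_zero hq)
  linear_combination -h1 - qPochInf q (q ^ 2) * h2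

theorem multipliable_set {q : ℂ} (hq : ‖q‖ < 1) (S : Set ℕ) :
    Multipliable fun n : S => 1 - q ^ (n : ℕ) := by
  simp only [sub_eq_add_neg]
  apply multipliable_one_add_of_summable
  simp only [norm_neg, norm_pow]
  exact (summable_geometric_of_lt_one (norm_nonneg _) hq).subtype S

/-- The product of `1 - q ^ n` over `n ∈ S`. -/
noncomputable def setProd (q : ℂ) (S : Set ℕ) : ℂ := ∏' n : S, (1 - q ^ (n : ℕ))

theorem setProd_union {q : ℂ} (hq : ‖q‖ < 1) {S T : Set ℕ} (h : Disjoint S T) :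
    setProd q (S ∪ T) = setProd q S * setProd q T :=
  Multipliable.tprod_union_disjoint (f := fun n : ℕ => 1 - q ^ n) h (multipliable_set hq S)
    (multipliable_set hq T)

/-- The arithmetic progression `a, a + m, a + 2 m, …`. -/
def progression (a m : ℕ) : Set ℕ := Set.range fun i => a + m * i

theorem setProd_progression (q : ℂ) (a : ℕ) {m : ℕ} (hm : m ≠ 0) :
    setProd q (progression a m) = qPochInf (q ^ a) (q ^ m) := by
  have hinj : Function.Injective fun i => a + m * i := fun i j h =>
    Nat.eq_of_mul_eq_mul_left (Nat.pos_of_ne_zero hm) (Nat.add_left_cancel h)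
  rw [setProd, progression, tprod_range (fun n : ℕ => 1 - q ^ n) hinj]
  exact tprod_congr fun i => by rw [pow_add, pow_mul]

theorem mem_progression {a m n : ℕ} (ha : 1 ≤ a) (ham : a ≤ m) :
    n ∈ progression a m ↔ 1 ≤ n ∧ n % m = a % m := by
  constructor
  · rintro ⟨i, rfl⟩
    exact ⟨by dsimp only; omega, by simp⟩
  · rintro ⟨hn, h⟩
    have h1 := Nat.div_add_mod n m
    rcases ham.lt_or_eq with h2 | rfl
    · rw [Nat.mod_eq_of_lt h2] at h
      exact ⟨n / m, by dsimp only; omega⟩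
    · rw [Nat.mod_self] at h
      obtain ⟨c, rfl⟩ := Nat.dvd_of_mod_eq_zero h
      obtain _ | c := c
      · simp at hn
      · exact ⟨c, by dsimp only; ring⟩

theorem mem_residueClasses {M : ℕ} {R : Set ℤ} (hR : ∀ r ∈ R, 0 < r ∧ r < M) {n : ℕ} :
    n ∈ residueClasses M R ↔
      1 ≤ n ∧ ∃ r ∈ R, ((n % M : ℕ) : ℤ) = r ∨ ((n % M : ℕ) : ℤ) = M - r := by
  refine and_congr_right fun _ => exists_congr fun r => and_congr_right fun hr => ?_
  obtain ⟨h1, h2⟩ := hR r hr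
  have e1 : r % M = r := Int.emod_eq_of_lt h1.le h2
  have e2 : -r % M = M - r := by
    rw [← Int.add_emod_right, neg_add_eq_sub]
    exact Int.emod_eq_of_lt (by omega) (by omega)
  rw [Int.ModEq, Int.ModEq, e1, e2, Int.natCast_mod]

theorem mod_half (n m : ℕ) : n % m = n % (2 * m) % m := by
  rw [Nat.mod_mul_left_mod]

theorem mod_half_cases {s m : ℕ} (hs : s < 2 * m) :
    s < m ∧ s % m = s ∨ m ≤ s ∧ s % m = s - m := by
  rcases lt_or_ge s m with h | h
  · exact Or.inl ⟨h, Nat.mod_eq_of_lt h⟩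
  · refine Or.inr ⟨h, ?_⟩
    rw [Nat.mod_eq_sub_mod h, Nat.mod_eq_of_lt (by omega)]

theorem mem_progression_half {a k n : ℕ} (ha : 1 ≤ a) (ham : a < 4 * k + 4) :
    n ∈ progression a (4 * k + 4) ↔
      1 ≤ n ∧ (n % (8 * k + 8) = a ∨ n % (8 * k + 8) = 4 * k + 4 + a) := by
  rw [mem_progression ha ham.le, mod_half, Nat.mod_eq_of_lt ham,
    show 2 * (4 * k + 4) = 8 * k + 8 by ring]
  have hs := Nat.mod_lt n (show 8 * k + 8 > 0 by omega)
  have := mod_half_cases (s := n % (8 * k + 8)) (m := 4 * k + 4) (by omega)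
  omega

theorem mem_progression_half_self {k n : ℕ} :
    n ∈ progression (4 * k + 4) (4 * k + 4) ↔
      1 ≤ n ∧ (n % (8 * k + 8) = 0 ∨ n % (8 * k + 8) = 4 * k + 4) := by
  rw [mem_progression (by omega) le_rfl, mod_half, Nat.mod_self,
    show 2 * (4 * k + 4) = 8 * k + 8 by ring]
  have hs := Nat.mod_lt n (show 8 * k + 8 > 0 by omega)
  have := mod_half_cases (s := n % (8 * k + 8)) (m := 4 * k + 4) (by omega)
  omega

theorem mem_progression_two {k n : ℕ} :
    n ∈ progression 2 2 ↔ 1 ≤ n ∧ n % (8 * k + 8) % 2 = 0 := by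
  rw [mem_progression (by omega) le_rfl, Nat.mod_mod_of_dvd n ⟨4 * k + 4, by ring⟩]

/-- The even positive integers congruent to one of `±2, ±4, …, ±2m` modulo `M`. -/
def evenClasses (M m : ℕ) : Set ℕ :=
  {n | 1 ≤ n ∧ n % M % 2 = 0 ∧ 1 ≤ n % M ∧ (n % M ≤ 2 * m ∨ M ≤ n % M + 2 * m)}

/-- As a + b is half the modulus, -a ≡ 4k+4+b and -b ≡ 4k+4+a. The four classes ±a, ±b thus pair up
into two progressions modulo 4k+4. -/
theorem residueClasses_eq {k a b m : ℕ} (ha : 1 ≤ a) (hab : a + b = 4 * k + 4) (hb : 1 ≤ b)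
    (hm : m ≤ 2 * k + 1) :
    residueClasses (8 * k + 8) ({(a : ℤ), (b : ℤ)} ∪ evensUpTo m) =
      progression a (4 * k + 4) ∪ progression b (4 * k + 4) ∪ evenClasses (8 * k + 8) m := by
  ext n
  have h := mem_residueClasses (M := 8 * k + 8) (R := {(a : ℤ), (b : ℤ)} ∪ evensUpTo m) (n := n)
    (by
      rintro r ((rfl | rfl) | ⟨j, hj1, hj2, rfl⟩)
      all_goals push_cast; omega)
  push_cast at h
  rw [h, Set.mem_union, Set.mem_union, mem_progression_half ha (by omega),
    mem_progression_half hb (by omega), evenClasses, Set.mem_ofPred_eq]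
  have hs := Nat.mod_lt n (show 8 * k + 8 > 0 by omega)
  have hcast : (n : ℤ) % (8 * k + 8) = ((n % (8 * k + 8) : ℕ) : ℤ) := by push_cast; rfl
  rw [hcast]
  generalize n % (8 * k + 8) = s at hs
  constructor
  · rintro ⟨hn, r, ((rfl | rfl) | ⟨j, hj1, hj2, rfl⟩), h | h⟩ <;> omega
  · rintro ((⟨hn, h | h⟩ | ⟨hn, h | h⟩) | ⟨hn, h1, h2, h | h⟩)
    · exact ⟨hn, a, by simp, by omega⟩
    · exact ⟨hn, b, by simp, by omega⟩
    · exact ⟨hn, b, by simp, by omega⟩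
    · exact ⟨hn, a, by simp, by omega⟩
    · exact ⟨hn, s, Or.inr ⟨s / 2, by omega, by omega, by omega⟩, by omega⟩
    · exact ⟨hn, (8 * k + 8 - s : ℕ), Or.inr ⟨(8 * k + 8 - s) / 2, by omega, by omega, by omega⟩,
        by omega⟩

/-- Oddness of `a` does two things: it makes `b` odd, so both progressions avoid the even classes,
and it excludes a = b = 2k+2. -/
theorem residueProd_eq {q : ℂ} (hq : ‖q‖ < 1) {k a b m : ℕ} (ha : 1 ≤ a)
    (hab : a + b = 4 * k + 4) (hb : 1 ≤ b) (hodd : a % 2 = 1)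
    (hm : m ≤ 2 * k + 1) :
    residueProd q (8 * k + 8) ({(a : ℤ), (b : ℤ)} ∪ evensUpTo m) =
      qPochInf (q ^ a) (q ^ (4 * k + 4)) * qPochInf (q ^ b) (q ^ (4 * k + 4)) *
        setProd q (evenClasses (8 * k + 8) m) := by
  have hd1 : Disjoint (progression a (4 * k + 4)) (progression b (4 * k + 4)) := by
    rw [Set.disjoint_left]
    intro n
    rw [mem_progression_half ha (by omega), mem_progression_half hb (by omega)]
    omega
  have hd2 : Disjoint (progression a (4 * k + 4) ∪ progression b (4 * k + 4))
      (evenClasses (8 * k + 8) m) := by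
    rw [Set.disjoint_left]
    intro n
    rw [Set.mem_union, mem_progression_half ha (by omega), mem_progression_half hb (by omega),
      evenClasses, Set.mem_ofPred_eq]
    omega
  change setProd q (residueClasses _ _) = _
  rw [residueClasses_eq ha hab hb hm, setProd_union hq hd2, setProd_union hq hd1,
    setProd_progression _ _ (by omega), setProd_progression _ _ (by omega)]

theorem qPochInf_sq_eq {q : ℂ} (hq : ‖q‖ < 1) (k : ℕ) :
    qPochInf (q ^ 2) (q ^ 2) = setProd q (evenClasses (8 * k + 8) (2 * k + 1)) *
      qPochInf (q ^ (4 * k + 4)) (q ^ (4 * k + 4)) := by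
  have hd : Disjoint (evenClasses (8 * k + 8) (2 * k + 1))
      (progression (4 * k + 4) (4 * k + 4)) := by
    rw [Set.disjoint_left]
    intro n
    rw [mem_progression_half_self, evenClasses, Set.mem_ofPred_eq]
    omega
  have he : progression 2 2 =
      evenClasses (8 * k + 8) (2 * k + 1) ∪ progression (4 * k + 4) (4 * k + 4) := by
    ext n
    rw [Set.mem_union, mem_progression_half_self, evenClasses, Set.mem_ofPred_eq,
      mem_progression_two (k := k)]
    have hs := Nat.mod_lt n (show 8 * k + 8 > 0 by omega)
    omega
  rw [← setProd_progression _ _ two_ne_zero, he, setProd_union hq hd,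
    setProd_progression _ _ (by omega)]

theorem setProd_evenClasses_succ {q : ℂ} (hq : ‖q‖ < 1) (k : ℕ) :
    setProd q (evenClasses (8 * k + 8) (2 * k + 1)) =
      setProd q (evenClasses (8 * k + 8) (2 * k)) *
        qPochInf (q ^ (4 * k + 2)) (q ^ (8 * k + 8)) *
        qPochInf (q ^ (4 * k + 6)) (q ^ (8 * k + 8)) := by
  have m1 : ∀ n, n ∈ progression (4 * k + 2) (8 * k + 8) ↔ 1 ≤ n ∧ n % (8 * k + 8) = 4 * k + 2 :=
    fun n => by rw [mem_progression (by omega) (by omega),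
      Nat.mod_eq_of_lt (show 4 * k + 2 < 8 * k + 8 by omega)]
  have m2 : ∀ n, n ∈ progression (4 * k + 6) (8 * k + 8) ↔ 1 ≤ n ∧ n % (8 * k + 8) = 4 * k + 6 :=
    fun n => by rw [mem_progression (by omega) (by omega),
      Nat.mod_eq_of_lt (show 4 * k + 6 < 8 * k + 8 by omega)]
  have hd1 : Disjoint (evenClasses (8 * k + 8) (2 * k)) (progression (4 * k + 2) (8 * k + 8)) := by
    rw [Set.disjoint_left]
    intro n
    rw [m1, evenClasses, Set.mem_ofPred_eq]
    omega
  have hd2 : Disjoint (evenClasses (8 * k + 8) (2 * k) ∪ progression (4 * k + 2) (8 * k + 8))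
      (progression (4 * k + 6) (8 * k + 8)) := by
    rw [Set.disjoint_left]
    intro n
    rw [Set.mem_union, m1, m2, evenClasses, Set.mem_ofPred_eq]
    omega
  have he : evenClasses (8 * k + 8) (2 * k + 1) = evenClasses (8 * k + 8) (2 * k) ∪
      progression (4 * k + 2) (8 * k + 8) ∪ progression (4 * k + 6) (8 * k + 8) := by
    ext n
    rw [Set.mem_union, Set.mem_union, m1, m2, evenClasses, evenClasses, Set.mem_ofPred_eq,
      Set.mem_ofPred_eq]
    omega
  rw [he, setProd_union hq hd2, setProd_union hq hd1, setProd_progression _ _ (by omega),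
    setProd_progression _ _ (by omega)]

theorem one_div_residueProd_eq_qPochInf₃ {q : ℂ} (hq : ‖q‖ < 1) (k : ℕ) :
    1 / residueProd q (8 * k + 8) ({2 * (k : ℤ) + 1, 2 * (k : ℤ) + 3} ∪ evensUpTo (2 * k)) =
      (qPochInf (q ^ 2) (q ^ 2))⁻¹ * qPochInf₃ (q ^ (4 * k + 4)) (-q ^ (2 * k + 1))
        (-q ^ (2 * k + 3)) (q ^ (4 * k + 4)) := by
  have hP := norm_pow_succ_lt hq (show 4 * k + 4 ≠ 0 by omega)
  have h1 := residueProd_eq hq (k := k) (a := 2 * k + 1) (b := 2 * k + 3) (m := 2 * k)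
    (by omega) (by omega) (by omega) (by omega) (by omega)
  have h2 := qPochInf_sq_eq hq k
  have h0 := qPochInf_self_ne_zero (norm_pow_succ_lt hq two_ne_zero)
  have ea := qPochInf_sq (q ^ (2 * k + 1)) hP
  have eb := qPochInf_sq (q ^ (2 * k + 3)) hP
  rw [show (q ^ (4 * k + 4)) ^ 2 = q ^ (8 * k + 8) by ring] at ea eb
  rw [show (q ^ (2 * k + 1)) ^ 2 = q ^ (4 * k + 2) by ring] at ea
  rw [show (q ^ (2 * k + 3)) ^ 2 = q ^ (4 * k + 6) by ring] at eb
  -- The classes ±(4k+2), absent from the residue product, supply the factors that split as (x²;y²)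
  -- = (x;y)(-x;y); the halves with -x are the theta factors.
  rw [setProd_evenClasses_succ hq k, ea, eb] at h2
  push_cast at h1
  rw [h1, qPochInf₃, h2]
  rw [h2] at h0
  simp only [mul_ne_zero_iff] at h0
  obtain ⟨⟨⟨h3, h4, h5⟩, h6, h7⟩, h8⟩ := h0
  field_simp

theorem div_residueProd_eq_qPochInf₃ {q : ℂ} (hq : ‖q‖ < 1) {k : ℕ} (hk : 1 ≤ k) :
    qPochInf (q ^ (4 * k - 2)) (q ^ (8 * k + 8)) * qPochInf (q ^ (4 * k + 10)) (q ^ (8 * k + 8)) /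
        residueProd q (8 * k + 8)
          ({2 * (k : ℤ) - 1, 2 * (k : ℤ) + 5} ∪ evensUpTo (2 * k + 1)) =
      (qPochInf (q ^ 2) (q ^ 2))⁻¹ * qPochInf₃ (q ^ (4 * k + 4)) (-q ^ (2 * k - 1))
        (-q ^ (2 * k + 5)) (q ^ (4 * k + 4)) := by
  have hP := norm_pow_succ_lt hq (show 4 * k + 4 ≠ 0 by omega)
  have h1 := residueProd_eq hq (k := k) (a := 2 * k - 1) (b := 2 * k + 5) (m := 2 * k + 1)
    (by omega) (by omega) (by omega) (by omega) (by omega)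
  have h2 := qPochInf_sq_eq hq k
  have h0 := qPochInf_self_ne_zero (norm_pow_succ_lt hq two_ne_zero)
  have ea := qPochInf_sq (q ^ (2 * k - 1)) hP
  have eb := qPochInf_sq (q ^ (2 * k + 5)) hP
  rw [show (q ^ (4 * k + 4)) ^ 2 = q ^ (8 * k + 8) by ring] at ea eb
  rw [← pow_mul, show (2 * k - 1) * 2 = 4 * k - 2 by omega] at ea
  rw [show (q ^ (2 * k + 5)) ^ 2 = q ^ (4 * k + 10) by ring] at eb
  have ha : qPochInf (q ^ (2 * k - 1)) (q ^ (4 * k + 4)) ≠ 0 :=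
    qPochInf_ne_zero hP (mul_pow_ne_one (norm_pow_succ_lt hq (by omega)) hP)
  have hb : qPochInf (q ^ (2 * k + 5)) (q ^ (4 * k + 4)) ≠ 0 :=
    qPochInf_ne_zero hP (mul_pow_ne_one (norm_pow_succ_lt hq (by omega)) hP)
  push_cast [show 1 ≤ 2 * k by omega] at h1
  rw [h1, qPochInf₃, h2, ea, eb]
  rw [h2] at h0
  obtain ⟨h3, h4⟩ := mul_ne_zero_iff.1 h0
  field_simp

theorem qPochInf_neg_div_split {q : ℂ} (hq : ‖q‖ < 1) :
    qPochInf (-q ^ 2) (q ^ 2) * qPochInf (-q) (q ^ 2) /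
      (qPochInf (q ^ 2) (q ^ 2) * qPochInf q (q ^ 2)) = qPochInf (-q) q / qPochInf q q := by
  rw [qPochInf_split (-q) hq, qPochInf_split q hq, neg_mul, ← sq, mul_comm, mul_comm (qPochInf q _)]

theorem qPochInf_neg_div_eq {q : ℂ} (hq : ‖q‖ < 1) :
    qPochInf (-q) q / qPochInf q q = 1 / (qPochInf q q * qPochInf q (q ^ 2)) := by
  have h := euler_distinct_odd hq
  have h1 := qPochInf_self_ne_zero hq
  have h2 := right_ne_zero_of_mul_eq_one h
  field_simp
  exact h

theorem qPochInf_neg_sq_div_eq {q : ℂ} (hq : ‖q‖ < 1) :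
    qPochInf (-q ^ 2) (q ^ 2) / qPochInf (q ^ 2) (q ^ 2) =
      1 / (qPochInf q q * qPochInf (-q) (q ^ 2)) := by
  have hp := norm_pow_succ_lt hq two_ne_zero
  rw [qPochInf_neg_div_eq hp]
  have h1 := qPochInf_split q hq
  have h2 := qPochInf_sq q hp
  rw [h2, h1, ← sq]
  congr 1
  ring

/-! ### The single-sum identities -/

theorem qPoch_neg_one_succ (p : ℂ) (n : ℕ) : qPoch (-1) p (n + 1) = 2 * qPoch (-p) p n := by
  rw [qPoch_succ', neg_one_mul]; ring

theorem exists_hasSum_pnat {f : ℕ → ℂ} {g : ℕ+ → ℂ} {S : ℂ} (hf : HasSum f S) (h0 : f 0 = 1)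
    (h : ∀ n : ℕ, f (n + 1) = 2 * g n.succPNat) : ∃ T, HasSum g T ∧ 1 + 2 * T = S := by
  refine ⟨(S - 1) / 2, ?_, by ring⟩
  rw [← Equiv.pnatEquivNat.symm.hasSum_iff]
  have h1 := (hasSum_nat_add_iff' 1).2 hf
  refine hasSum_of_eq (h1.div_const 2) (fun n => ?_) (by simp [h0])
  rw [h n, mul_div_cancel_left₀ _ two_ne_zero]
  rfl

theorem denom_equivNat (q : ℂ) (n : ℕ) : (equivNat n).denom q = qPoch q q (2 * n) := by
  have h := tailTerm_equivNat q n
  simpa [tailTerm, invPoch] using h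

theorem n₂_equivNat (n : ℕ) : (equivNat n).n₂ = n ^ 2 := by
  rw [n₂_eq]; simp [first_equivNat]

end RRSums

theorem theorem3 (q : ℂ) (hq : ‖q‖ < 1) :
    (∀ k : ℕ, 1 ≤ k →
      HasSum (fun l : RRSums.BddPartition k => q ^ (2 * l.n₂) / l.denom q)
        (1 / RRSums.residueProd q (8 * k + 8)
          ({2 * (k : ℤ) + 1, 2 * (k : ℤ) + 3} ∪ RRSums.evensUpTo (2 * k))) ∧
      HasSum (fun l : RRSums.BddPartition k =>
          q ^ (2 * l.n₂ - 2 * l.first) / l.denom q * (1 - q ^ (2 * l.first)))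
        (RRSums.qPochInf (q ^ (4 * k - 2)) (q ^ (8 * k + 8)) *
            RRSums.qPochInf (q ^ (4 * k + 10)) (q ^ (8 * k + 8)) /
          RRSums.residueProd q (8 * k + 8)
            ({2 * (k : ℤ) - 1, 2 * (k : ℤ) + 5} ∪ RRSums.evensUpTo (2 * k + 1))) ∧
      HasSum (fun l : RRSums.BddPartition k =>
          q ^ (2 * l.n₂ - l.first ^ 2) / l.denom q * RRSums.qPoch (-q) (q ^ 2) l.first)
        (RRSums.qPochInf (-q) (q ^ 2) / RRSums.qPochInf (q ^ 2) (q ^ 2) *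
          RRSums.qPochInf₃ (q ^ (4 * k + 2)) (-q ^ (2 * k)) (-q ^ (2 * k + 2))
            (q ^ (4 * k + 2))) ∧
      HasSum (fun l : RRSums.BddPartition k =>
          q ^ (2 * l.n₂ - l.first ^ 2 - l.first) / l.denom q *
            RRSums.qPoch (-1) (q ^ 2) l.first * (1 - q ^ (2 * l.first)))
        (2 * (RRSums.qPochInf (-q ^ 2) (q ^ 2) / RRSums.qPochInf (q ^ 2) (q ^ 2)) *
          RRSums.qPochInf₃ (q ^ (4 * k + 2)) (-q ^ (2 * k - 1)) (-q ^ (2 * k + 3))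
            (q ^ (4 * k + 2))) ∧
      HasSum (fun l : RRSums.BddPartition k =>
          q ^ (2 * l.n₂ - 2 * l.first ^ 2 + l.first) / l.denom q *
            RRSums.qPoch (-1) (q ^ 2) l.first * RRSums.qPoch (-q) (q ^ 2) l.first)
        (RRSums.qPochInf (-q) q / RRSums.qPochInf q q *
          RRSums.qPochInf₃ (q ^ (4 * k)) (-q ^ (2 * k)) (-q ^ (2 * k)) (q ^ (4 * k))) ∧
      HasSum (fun l : RRSums.BddPartition k =>
          q ^ (2 * l.n₂ - l.first ^ 2 + l.first) / l.denom q *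
            RRSums.qPoch (-1) (q ^ 2) l.first)
        (RRSums.qPochInf (-q ^ 2) (q ^ 2) / RRSums.qPochInf (q ^ 2) (q ^ 2) *
          RRSums.qPochInf₃ (q ^ (4 * k + 2)) (-q ^ (2 * k + 1)) (-q ^ (2 * k + 1))
            (q ^ (4 * k + 2)))) ∧
    (∃ S : ℂ,
      HasSum (fun n : ℕ+ =>
        q ^ (n : ℕ) * RRSums.qPoch (-q) q (2 * n - 1) / RRSums.qPoch q q (2 * n)) S ∧
      1 + 2 * S =
        RRSums.qPochInf₃ (q ^ 4) (-q ^ 2) (-q ^ 2) (q ^ 4) /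
          (RRSums.qPochInf q q * RRSums.qPochInf q (q ^ 2))) ∧
    (∃ S : ℂ,
      HasSum (fun n : ℕ+ =>
        q ^ ((n : ℕ) * (n + 1)) * RRSums.qPoch (-q ^ 2) (q ^ 2) (n - 1) /
          RRSums.qPoch q q (2 * n)) S ∧
      1 + 2 * S =
        RRSums.qPochInf₃ (q ^ 6) (-q ^ 3) (-q ^ 3) (q ^ 6) /
          (RRSums.qPochInf q q * RRSums.qPochInf (-q) (q ^ 2))) := by
  refine ⟨fun k hk => ?_, ?_, ?_⟩
  · obtain ⟨k, rfl⟩ := Nat.exists_eq_add_of_le' hk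
    refine ⟨?_, ?_, RRSums.hasSum_mul_qPoch_neg_self hq k,
      RRSums.hasSum_mul_qPoch_neg_one_mul_one_sub hq k, ?_,
      RRSums.hasSum_mul_qPoch_neg_one hq k⟩
    · rw [RRSums.one_div_residueProd_eq_qPochInf₃ hq]
      exact RRSums.hasSum_pow_n₂ hq k
    · rw [RRSums.div_residueProd_eq_qPochInf₃ hq hk]
      exact RRSums.hasSum_pow_n₂_mul_one_sub hq k
    · rw [← RRSums.qPochInf_neg_div_split hq]
      exact RRSums.hasSum_mul_qPoch_neg_one_mul_qPoch_neg_self hq k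
  · have h := RRSums.hasSum_mul_qPoch_neg_one_mul_qPoch_neg_self hq 0
    rw [RRSums.qPochInf_neg_div_split hq, RRSums.qPochInf_neg_div_eq hq, one_div_mul_eq_div] at h
    refine RRSums.exists_hasSum_pnat (RRSums.BddPartition.equivNat.hasSum_iff.2 h) ?_ fun n => ?_
    · simp [RRSums.denom_equivNat, RRSums.n₂_equivNat, RRSums.BddPartition.first_equivNat,
        RRSums.qPoch_zero]
    -- Splitting by parity of the index merges (-q²;q²)_n (-q;q²)_{n+1} into (-q;q)_{2n+1}.
    · have h1 := RRSums.qPoch_split (-q) q n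
      rw [neg_mul, ← sq] at h1
      simp only [Function.comp_apply, RRSums.denom_equivNat, RRSums.n₂_equivNat,
        RRSums.BddPartition.first_equivNat, RRSums.qPoch_neg_one_succ, Nat.sub_self, zero_add,
        Nat.succPNat_coe, Nat.succ_eq_add_one, show 2 * (n + 1) - 1 = 2 * n + 1 by omega,
        RRSums.qPoch_succ _ _ (2 * n), h1, RRSums.qPoch_succ (-q) (q ^ 2)]
      ring
  · have h := RRSums.hasSum_mul_qPoch_neg_one hq 0
    rw [RRSums.qPochInf_neg_sq_div_eq hq, one_div_mul_eq_div] at h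
    refine RRSums.exists_hasSum_pnat (RRSums.BddPartition.equivNat.hasSum_iff.2 h) ?_ fun n => ?_
    · simp [RRSums.denom_equivNat, RRSums.n₂_equivNat, RRSums.BddPartition.first_equivNat,
        RRSums.qPoch_zero]
    · simp only [Function.comp_apply, RRSums.denom_equivNat, RRSums.n₂_equivNat,
        RRSums.BddPartition.first_equivNat, RRSums.qPoch_neg_one_succ, Nat.succPNat_coe,
        Nat.succ_eq_add_one, Nat.add_sub_cancel,
        show 2 * (n + 1) ^ 2 - (n + 1) ^ 2 + (n + 1) = (n + 1) * (n + 1 + 1) by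
          rw [two_mul, Nat.add_sub_cancel]; ring]
      ring
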